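/- Let $\Bbbk$ be a field of characteristic $0$, and let $\mathsf{L}_1=\mathsf{L}_1(1)$ be the Lie algebra of polynomial vector fields $f\partial$ on the line with $f\in z^2\Bbbk[z]$; it has the basis $e_k=z^{k+1}\partial$, $k\ge 1$, and the bracket $[e_k,e_m]=(m-k)e_{k+m}$. For $\lambda,\mu\in\Bbbk$ let $\mathcal{T}_{\lambda,\mu}=\Bbbk[z]\,z^{\mu}\partial^{-\lambda}$ be the $\mathsf{L}_1$-module with underlying space $\Bbbk[z]$ and action $$ e_k\cdot z^{m}(z^{\mu}\partial^{-\lambda})=(m+\mu+(k+1)\lambda)\,z^{m+k}(z^{\mu}\partial^{-\lambda}). $$ Then for every $r\ge 0$ and all tuples $\bar\lambda=(\lambda_1,\ldots,\lambda_r)$, $\bar\mu=(\mu_1,\ldots,\mu_r)$ in $\Bbbk^r$, the tensor product (over $\Bbbk$, with the diagonal action) $$ \mathcal{T}^r_{\bar\lambda,\bar\mu}=\mathcal{T}_{\lambda_1,\mu_1}\otimes\cdots\otimes\mathcal{T}_{\lambda_r,\mu_r} $$ is a noetherian $\mathsf{L}_1$-module, i.e. its $\mathsf{L}_1$-submodules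 satisfy the ascending chain condition. -/

import Mathlib

open Polynomial
open scoped TensorProduct

noncomputable section

namespace VectorFields

/-- The Lie algebra `L₁ = L₁(1)` of polynomial vector fields `f ∂` on the line (derivations of
`K[z]`, with the commutator bracket) whose coefficient `f` vanishes to order at least two at the
origin.  It has the basis `e_k = z ^ (k + 1) ∂`, `k ≥ 1`. -/
def L1 (K : Type*) [Field K] : LieSubalgebra K (Derivation K K[X] K[X]) where
  carrier := {D | (X : K[X]) ^ 2 ∣ D X}
  zero_mem' := by simp
  add_mem' := by
    intro D E hD hE
    simpa using dvd_add hD hE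
  smul_mem' := by
    intro c D hD
    simpa using dvd_smul_of_dvd c hD
  lie_mem' := by
    have key : ∀ D E : Derivation K K[X] K[X], (X : K[X]) ^ 2 ∣ D X → (X : K[X]) ^ 2 ∣ E X →
        (X : K[X]) ^ 2 ∣ D (E X) := by
      rintro D E hD ⟨g, hg⟩
      rw [hg, Derivation.leibniz, Derivation.leibniz_pow]
      simp only [smul_eq_mul, nsmul_eq_mul]
      exact dvd_add (Dvd.intro _ rfl)
        (Dvd.dvd.mul_left (Dvd.dvd.mul_left (Dvd.dvd.mul_left hD _) _) _)
    intro D E hD hE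
    change (X : K[X]) ^ 2 ∣ ⁅D, E⁆ X
    rw [Derivation.commutator_apply]
    exact dvd_sub (key D E hD hE) (key E D hE hD)

/-- The underlying space `K[z]` of the module `T_{λ,μ} = K[z] z^μ ∂^{-λ}`; the polynomial `g`
stands for `g z^μ ∂^{-λ}`. -/
def TensorField (K : Type*) [Field K] (_lam _mu : K) : Type _ := K[X]

namespace TensorField

variable {K : Type*} [Field K] {lam mu : K}

instance : AddCommGroup (TensorField K lam mu) := inferInstanceAs (AddCommGroup K[X])

instance : Module K (TensorField K lam mu) := inferInstanceAs (Module K K[X])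

/-- The action of a vector field `D = f ∂`, `f = D z`, on `g z^μ ∂^{-λ}`:
`f ∂ · g z^μ ∂^{-λ} = (f g' + μ (f / z) g + λ f' g) z^μ ∂^{-λ}`.
Since `z` divides `f`, the quotient `f / z` is `f.divX`. -/
def action (lam mu : K) (D : Derivation K K[X] K[X]) (g : K[X]) : K[X] :=
  D X * derivative g + C mu * (D X).divX * g + C lam * derivative (D X) * g

theorem action_add_left (lam mu : K) (D E : Derivation K K[X] K[X]) (g : K[X]) :
    action lam mu (D + E) g = action lam mu D g + action lam mu E g := by
  simp only [action, Derivation.add_apply, divX_add, derivative_add]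
  ring

theorem action_add_right (lam mu : K) (D : Derivation K K[X] K[X]) (g h : K[X]) :
    action lam mu D (g + h) = action lam mu D g + action lam mu D h := by
  simp only [action, derivative_add]
  ring

theorem action_smul_left (lam mu c : K) (D : Derivation K K[X] K[X]) (g : K[X]) :
    action lam mu (c • D) g = c • action lam mu D g := by
  simp only [action, Derivation.smul_apply, smul_eq_C_mul, divX_C_mul, derivative_C_mul]
  ring

theorem action_smul_right (lam mu c : K) (D : Derivation K K[X] K[X]) (g : K[X]) :
    action lam mu D (c • g) = c • action lam mu D g := by
  simp only [action, smul_eq_C_mul, derivative_C_mul]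
  ring

theorem action_lie (lam mu : K) (D E : Derivation K K[X] K[X]) (hD : (X : K[X]) ^ 2 ∣ D X)
    (hE : (X : K[X]) ^ 2 ∣ E X) (g : K[X]) :
    action lam mu D (action lam mu E g) =
      action lam mu ⁅D, E⁆ g + action lam mu E (action lam mu D g) := by
  obtain ⟨f, hf⟩ := hD
  obtain ⟨h, hh⟩ := hE
  have divX_sq : ∀ p : K[X], (X ^ 2 * p).divX = X * p := fun p => by
    ext n
    rw [coeff_divX, show X ^ 2 * p = X * p * X by ring, coeff_mul_X]
  have hDE : ∀ (G : Derivation K K[X] K[X]) (p : K[X]), G p = derivative p * G X := fun G p => by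
    have : mkDerivation K (G X) = G := derivation_ext (by simp)
    conv_lhs => rw [← this, mkDerivation_apply, smul_eq_mul]
  have hbr : ⁅D, E⁆ X = X ^ 2 * (X ^ 2 * derivative h * f - X ^ 2 * derivative f * h) := by
    rw [Derivation.commutator_apply, hDE D (E X), hDE E (D X), hf, hh]
    simp only [derivative_mul, derivative_X_pow]
    simp
    ring
  have h2 : (C (2 : K) : K[X]) = 2 := rfl
  simp only [action, hbr, hf, hh, divX_sq, derivative_mul, derivative_add, derivative_sub,
    derivative_X_pow, derivative_C, derivative_X]
  simp [h2]
  ring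

instance : LieRingModule (L1 K) (TensorField K lam mu) where
  bracket D g := action lam mu (D : Derivation K K[X] K[X]) g
  add_lie D E g := action_add_left lam mu D E g
  lie_add D g h := action_add_right lam mu D g h
  leibniz_lie D E g := action_lie lam mu D E D.2 E.2 g

instance : LieModule K (L1 K) (TensorField K lam mu) where
  smul_lie c D g := action_smul_left lam mu c D g
  lie_smul c D g := action_smul_right lam mu c D g

end TensorField

section PiTensor

variable {ι K L : Type*} [DecidableEq ι] [Field K] [LieRing L] [LieAlgebra K L]
  {M : ι → Type*} [∀ i, AddCommGroup (M i)] [∀ i, Module K (M i)]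
  [∀ i, LieRingModule L (M i)] [∀ i, LieModule K L (M i)]

/-- The operator `id ⊗ ⋯ ⊗ a ⊗ ⋯ ⊗ id` with `a` in the factor number `i`. -/
def factorEnd (i : ι) : Module.End K (M i) →ₗ[K] Module.End K (⨂[K] i, M i) :=
  (PiTensorProduct.mapMultilinear K M M).toLinearMap (fun _ => LinearMap.id) i

theorem factorEnd_mul (i : ι) (a b : Module.End K (M i)) :
    factorEnd i (a * b) = factorEnd i a * factorEnd i b := by
  change PiTensorProduct.map _ = PiTensorProduct.map _ * PiTensorProduct.map _
  rw [← PiTensorProduct.map_mul]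
  congr 1
  funext j
  rcases eq_or_ne j i with rfl | h
  · simp
  · simp only [Function.update_of_ne h]
    rfl

theorem factorEnd_commute {i j : ι} (h : i ≠ j) (a : Module.End K (M i))
    (b : Module.End K (M j)) : ⁅factorEnd i a, factorEnd j b⁆ = 0 := by
  rw [LieRing.of_associative_ring_bracket, sub_eq_zero]
  change PiTensorProduct.map _ * PiTensorProduct.map _ =
    PiTensorProduct.map _ * PiTensorProduct.map _
  rw [← PiTensorProduct.map_mul, ← PiTensorProduct.map_mul]
  congr 1
  funext l
  rcases eq_or_ne l i with rfl | hl
  · simp only [Function.update_of_ne h]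
    rfl
  · simp only [Function.update_of_ne hl]
    rfl

variable [Fintype ι]

/-- The diagonal (Leibniz) action of a Lie algebra on a tensor product of Lie modules:
`x · (v₁ ⊗ ⋯ ⊗ v_r) = ∑ i, v₁ ⊗ ⋯ ⊗ (x · v_i) ⊗ ⋯ ⊗ v_r`. -/
def diagAction : L →ₗ[K] Module.End K (⨂[K] i, M i) :=
  ∑ i, factorEnd i ∘ₗ (LieModule.toEnd K L (M i) : L →ₗ[K] Module.End K (M i))

theorem diagAction_lie (x y : L) :
    diagAction (K := K) (M := M) ⁅x, y⁆ =
      ⁅diagAction (K := K) (M := M) x, diagAction (K := K) (M := M) y⁆ := by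
  have hsum : ∀ z : L, diagAction (K := K) (M := M) z =
      ∑ i, factorEnd i (LieModule.toEnd K L (M i) z) := fun z => by
    simp [diagAction]
  simp only [hsum]
  rw [LieRing.of_associative_ring_bracket, Finset.sum_mul_sum, Finset.sum_mul_sum,
    Finset.sum_comm (s := Finset.univ) (t := Finset.univ)
      (f := fun i j => factorEnd i (LieModule.toEnd K L (M i) y) *
        factorEnd j (LieModule.toEnd K L (M j) x)),
    ← Finset.sum_sub_distrib]
  refine Finset.sum_congr rfl fun i _ => ?_
  rw [← Finset.sum_sub_distrib, Finset.sum_eq_single i]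
  · have h : LieModule.toEnd K L (M i) ⁅x, y⁆ =
        LieModule.toEnd K L (M i) x * LieModule.toEnd K L (M i) y -
          LieModule.toEnd K L (M i) y * LieModule.toEnd K L (M i) x := by
      ext v
      simp
    rw [h, map_sub, factorEnd_mul, factorEnd_mul]
  · intro j _ hj
    exact factorEnd_commute hj.symm _ _
  · simp

instance : LieRingModule L (⨂[K] i, M i) where
  bracket x v := diagAction x v
  add_lie x y v := by
    change diagAction (x + y) v = diagAction x v + diagAction y v
    simp
  lie_add x v w := map_add _ v w
  leibniz_lie x y v := by
    change diagAction x (diagAction y v) = diagAction ⁅x, y⁆ v + diagAction y (diagAction x v)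
    rw [diagAction_lie, LieRing.of_associative_ring_bracket]
    simp

instance : LieModule K L (⨂[K] i, M i) where
  smul_lie c x v := by
    change diagAction (c • x) v = c • diagAction x v
    simp
  lie_smul c x v := map_smul _ c v

end PiTensor

/-- The `L₁`-module `T_{λ̄,μ̄} = T_{λ₁,μ₁} ⊗ ⋯ ⊗ T_{λ_r,μ_r}`, with the diagonal action. -/
abbrev TensorFields (K : Type*) [Field K] {r : ℕ} (lam mu : Fin r → K) : Type _ :=
  ⨂[K] i, TensorField K (lam i) (mu i)

/-- A module over a Lie algebra is noetherian if its submodules satisfy the ascending chain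
condition. -/
def IsNoetherianLieModule (K L M : Type*) [Field K] [LieRing L] [LieAlgebra K L]
    [AddCommGroup M] [Module K M] [LieRingModule L M] : Prop :=
  ∀ N : ℕ →o LieSubmodule K L M, ∃ n, ∀ m, n ≤ m → N n = N m

end VectorFields

end

/-! The tensor product is the image of `K[z_1, …, z_r]`, with `e_k` acting as `∑ z_i^k (z_i ∂_i +
μ_i + (k+1) λ_i)`; the proof is by induction on `r`. The fields preserve every diagonal `z_i = z_j`
and every hyperplane `z_i = 0`, so the quotient by such a linear form is a module of the same kind
in one variable fewer, up to a twist. Each such twist is a standard one plus the logarithmic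
derivative of some polynomial `h`, and multiplication by `h` embeds the twisted module into a
standard one (`noeth_of_mem_twists`). Hence chains of submodules stabilize modulo any product of
these linear forms (`NoethModFactors.mul`).

It remains to control chains inside multiples of one such product. A word `e_{a_1} ⋯ e_{a_r}`
expands as a sum over maps `φ` recording the variable on which each letter acts. Combine words with
the coefficients of a symmetric polynomial that vanishes to order `r + 1` on the diagonals: the
terms with `φ` not injective die, and the others coincide (`diagSymbol_mem`). Compose two such
operations and insert a high power of the difference of the products of the two sets of coefficient
variables. Only the leading part survives: every submodule `N` is mapped into itself by `f t D` for
all symmetric `t`, where `f` is a fixed product of linear forms and `D = ∏_{λ_i = 0} (z_i ∂_i +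
μ_i)`, provided no `λ_i` is `1` (`zeroOp_mem`).

The rest is commutative algebra over the symmetric polynomials `S`, over which `K[z]` is a
noetherian module. For a chain `N_n`, the `S`-spans of `D N_n` reach a limit `Q`, with `f Q ⊆ N_n`
and `D N_n ⊆ Q` for large `n`. The `f`-saturation `A` of `Q` is `D`-stable because `D` is a
differential operator; if `D` is injective, `D x ∈ A` forces `x ∈ A`. So the multiples of a power of
`f` lying in a late `N_m` already lie in an earlier term (`noeth_stdTwist_of_generic`). The excluded
parameters are reached by the de Rham differential, for `λ_i = 1`, and by multiplication by a
monomial, for `μ_i ∈ {0, -1, -2, …}`. -/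

namespace VectorFields

/-! ### Chain conditions relative to a subspace -/

section Chains

variable {K M M' : Type*} [Field K] [AddCommGroup M] [Module K M] [AddCommGroup M'] [Module K M']

/-- A subspace is stable under a sequence of operators. -/
def IsStable (e : ℕ → Module.End K M) (N : Submodule K M) : Prop :=
  ∀ k, ∀ x ∈ N, e k x ∈ N

/-- Ascending chains of stable subspaces stabilize modulo `T`. -/
def NoethMod (e : ℕ → Module.End K M) (T : Submodule K M) : Prop :=
  ∀ N : ℕ →o Submodule K M, (∀ n, IsStable e (N n)) → ∃ n, ∀ m, n ≤ m → N m ≤ N n ⊔ T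

/-- Ascending chains of stable subspaces stabilize. -/
def Noeth (e : ℕ → Module.End K M) : Prop := NoethMod e ⊥

theorem NoethMod.mono {e : ℕ → Module.End K M} {T T' : Submodule K M} (h : NoethMod e T)
    (hT : T ≤ T') : NoethMod e T' := fun N hN => by
  obtain ⟨n, hn⟩ := h N hN
  exact ⟨n, fun m hm => (hn m hm).trans (sup_le_sup_left hT _)⟩

theorem noethMod_top (e : ℕ → Module.End K M) : NoethMod e ⊤ := fun _ _ => ⟨0, by simp⟩

/-- The preimages of a chain of subspaces. -/
def comapChain (φ : M →ₗ[K] M') (N : ℕ →o Submodule K M') : ℕ →o Submodule K M :=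
  ⟨fun n => (N n).comap φ, fun _ _ h => Submodule.comap_mono (N.monotone h)⟩

/-- The images of a chain of subspaces. -/
def mapChain (φ : M →ₗ[K] M') (N : ℕ →o Submodule K M) : ℕ →o Submodule K M' :=
  ⟨fun n => (N n).map φ, fun _ _ h => Submodule.map_mono (N.monotone h)⟩

variable {e : ℕ → Module.End K M} {e' : ℕ → Module.End K M'}

theorem IsStable.comap {φ : M →ₗ[K] M'} (hφ : ∀ k x, φ (e k x) = e' k (φ x))
    {N : Submodule K M'} (hN : IsStable e' N) : IsStable e (N.comap φ) := fun k x hx => by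
  rw [Submodule.mem_comap, hφ]
  exact hN k _ hx

theorem IsStable.map {φ : M →ₗ[K] M'} (hφ : ∀ k x, φ (e k x) = e' k (φ x))
    {N : Submodule K M} (hN : IsStable e N) : IsStable e' (N.map φ) := by
  rintro k _ ⟨x, hx, rfl⟩
  exact ⟨e k x, hN k x hx, hφ k x⟩

theorem Noeth.noethMod_ker {φ : M →ₗ[K] M'} (hφ : ∀ k x, φ (e k x) = e' k (φ x))
    (h : Noeth e') : NoethMod e (LinearMap.ker φ) := fun N hN => by
  obtain ⟨n, hn⟩ := h (mapChain φ N) fun n => (hN n).map hφ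
  refine ⟨n, fun m hm x hx => ?_⟩
  have hx' := hn m hm (⟨x, hx, rfl⟩ : φ x ∈ mapChain φ N m)
  rw [sup_bot_eq] at hx'
  obtain ⟨y, hy, hxy⟩ := hx'
  exact Submodule.mem_sup.2 ⟨y, hy, x - y, by simp [hxy], by simp⟩

theorem Noeth.of_injective {φ : M →ₗ[K] M'} (hφ : ∀ k x, φ (e k x) = e' k (φ x))
    (hinj : Function.Injective φ) (h : Noeth e') : Noeth e :=
  (h.noethMod_ker hφ).mono (LinearMap.ker_eq_bot.2 hinj).le

/-- The usual extension argument: stabilize the chain modulo the image of `ψ`, then stabilize its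
preimage in `M'`. Keeping `T` instead of `⊥` allows linear factors to be peeled off one at a time.
-/
theorem NoethMod.extend {ψ : M' →ₗ[K] M} (hψ : ∀ k x, ψ (e' k x) = e k (ψ x))
    {T : Submodule K M'} (h : NoethMod e (LinearMap.range ψ)) (h' : NoethMod e' T) :
    NoethMod e (T.map ψ) := fun N hN => by
  obtain ⟨n₁, h₁⟩ := h N hN
  obtain ⟨n₂, h₂⟩ := h' (comapChain ψ N) fun n => (hN n).comap hψ
  refine ⟨max n₁ n₂, fun m hm x hx => ?_⟩
  obtain ⟨y, hy, _, ⟨z, rfl⟩, rfl⟩ := Submodule.mem_sup.1 (h₁ m (le_of_max_le_left hm) hx)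
  have hz : z ∈ comapChain ψ N m := by
    change ψ z ∈ N m
    simpa using (N m).sub_mem hx (N.monotone (le_of_max_le_left hm) hy)
  obtain ⟨z₁, hz₁, t, ht, rfl⟩ := Submodule.mem_sup.1 (h₂ m (le_of_max_le_right hm) hz)
  refine Submodule.mem_sup.2 ⟨y + ψ z₁, ?_, ψ t, ⟨t, ht, rfl⟩, by rw [map_add, add_assoc]⟩
  exact add_mem (N.monotone (le_max_left _ _) hy) (N.monotone (le_max_right n₁ n₂) hz₁)

theorem Noeth.extend {ψ : M' →ₗ[K] M} (hψ : ∀ k x, ψ (e' k x) = e k (ψ x))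
    (h : NoethMod e (LinearMap.range ψ)) (h' : Noeth e') : Noeth e := by
  simpa [Noeth] using NoethMod.extend hψ h h'

theorem Noeth.of_surjective {ψ : M' →ₗ[K] M} (hψ : ∀ k x, ψ (e' k x) = e k (ψ x))
    (hsurj : Function.Surjective ψ) (h' : Noeth e') : Noeth e :=
  h'.extend hψ (by rw [LinearMap.range_eq_top.2 hsurj]; exact noethMod_top e)

end Chains

/-! ### Twisted vector fields and their restriction to diagonals and hyperplanes -/

section Operators

variable {K : Type*} [Field K] {r n : ℕ}

/-- The derivation `∑ i, z_i ^ (k + 1) ∂_i`. -/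
noncomputable def vectorField (K : Type*) [Field K] (r k : ℕ) :
    Derivation K (MvPolynomial (Fin r) K) (MvPolynomial (Fin r) K) :=
  MvPolynomial.mkDerivation K fun i => MvPolynomial.X i ^ (k + 1)

/-- The action of `e_{k+1}`: a vector field plus the multiplication by `a k`. -/
noncomputable def twistedField (a : ℕ → MvPolynomial (Fin r) K) (k : ℕ) :
    Module.End K (MvPolynomial (Fin r) K) :=
  (vectorField K r (k + 1) : MvPolynomial (Fin r) K →ₗ[K] MvPolynomial (Fin r) K) + LinearMap.mulLeft K (a k)

theorem twistedField_apply (a : ℕ → MvPolynomial (Fin r) K) (k : ℕ) (p : MvPolynomial (Fin r) K) :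
    twistedField a k p = vectorField K r (k + 1) p + a k * p := rfl

/-- The twist attached to a tensor product of modules of tensor fields. -/
noncomputable def stdTwist (lam mu : Fin r → K) (k : ℕ) : MvPolynomial (Fin r) K :=
  ∑ i, MvPolynomial.C (mu i + (k + 2) * lam i) * MvPolynomial.X i ^ (k + 1)

/-- The quotient of `x ^ (k + 2) - y ^ (k + 2)` by `x - y`. -/
def dividedDiff {A : Type*} [CommRing A] (x y : A) (k : ℕ) : A :=
  ∑ t ∈ Finset.range (k + 2), x ^ t * y ^ (k + 2 - 1 - t)

theorem dividedDiff_mul {A : Type*} [CommRing A] (x y : A) (k : ℕ) :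
    dividedDiff x y k * (x - y) = x ^ (k + 2) - y ^ (k + 2) := geom_sum₂_mul x y (k + 2)

theorem dividedDiff_self {A : Type*} [CommRing A] (x : A) (k : ℕ) :
    dividedDiff x x k = (k + 2) * x ^ (k + 1) := by
  rw [dividedDiff, Finset.sum_congr rfl (g := fun _ => x ^ (k + 1))]
  · simp
  · intro t ht
    rw [← pow_add]
    congr 1
    have := Finset.mem_range.1 ht
    omega

theorem dividedDiff_zero_left {A : Type*} [CommRing A] (x : A) (k : ℕ) :
    dividedDiff 0 x k = x ^ (k + 1) := by
  rw [dividedDiff, Finset.sum_eq_single 0]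
  · simp
  · intro t _ ht
    simp [ht]
  · simp

theorem dividedDiff_zero_right {A : Type*} [CommRing A] (x : A) (k : ℕ) :
    dividedDiff x 0 k = x ^ (k + 1) := by
  rw [dividedDiff, Finset.sum_eq_single (k + 1)]
  · simp
  · intro t ht h
    have := Finset.mem_range.1 ht
    rw [zero_pow (by omega), mul_zero]
  · simp

/-- The generators of the twists. -/
inductive IsTwistGen : (ℕ → MvPolynomial (Fin r) K) → Prop
  | weight (c : K) (i : Fin r) : IsTwistGen fun k => MvPolynomial.C c * MvPolynomial.X i ^ (k + 1)
  | density (c : K) (i : Fin r) : IsTwistGen fun k =>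
      MvPolynomial.C (c * (k + 2)) * MvPolynomial.X i ^ (k + 1)
  | pair (i j : Fin r) : IsTwistGen (dividedDiff (MvPolynomial.X i) (MvPolynomial.X j))

/-- The twists which arise from tensor products of modules of tensor fields by dividing by, and by
restricting to, diagonals and coordinate hyperplanes. -/
noncomputable def twists (K : Type*) [Field K] (r : ℕ) : AddSubmonoid (ℕ → MvPolynomial (Fin r) K) :=
  AddSubmonoid.closure {a | IsTwistGen a}

theorem twists_weight (c : K) (i : Fin r) :
    (fun k => MvPolynomial.C c * MvPolynomial.X i ^ (k + 1)) ∈ twists K r :=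
  AddSubmonoid.subset_closure (.weight c i)

theorem twists_density (c : K) (i : Fin r) :
    (fun k : ℕ => MvPolynomial.C (c * (k + 2)) * MvPolynomial.X i ^ (k + 1)) ∈ twists K r :=
  AddSubmonoid.subset_closure (.density c i)

theorem twists_pair (i j : Fin r) :
    dividedDiff (MvPolynomial.X i) (MvPolynomial.X j) ∈ twists K r :=
  AddSubmonoid.subset_closure (.pair i j)

theorem stdTwist_mem (lam mu : Fin r → K) : stdTwist lam mu ∈ twists K r := by
  have : stdTwist lam mu = ∑ i, ((fun k => MvPolynomial.C (mu i) * MvPolynomial.X i ^ (k + 1)) +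
      (fun k : ℕ => MvPolynomial.C (lam i * (k + 2)) * MvPolynomial.X i ^ (k + 1))) := by
    funext k
    simp only [stdTwist, Finset.sum_apply, Pi.add_apply, MvPolynomial.C_add, add_mul,
      mul_comm (lam _)]
  rw [this]
  exact sum_mem fun i _ => add_mem (twists_weight _ _) (twists_density _ _)

theorem stdTwist_add (lam mu lam' mu' : Fin r → K) (k : ℕ) :
    stdTwist (lam + lam') (mu + mu') k = stdTwist lam mu k + stdTwist lam' mu' k := by
  simp only [stdTwist, ← Finset.sum_add_distrib, ← add_mul, ← MvPolynomial.C_add, Pi.add_apply]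
  refine Finset.sum_congr rfl fun i _ => ?_
  congr 2
  ring

theorem stdTwist_single_mu (c : K) (i : Fin r) (k : ℕ) :
    stdTwist 0 (Pi.single i c) k = MvPolynomial.C c * MvPolynomial.X i ^ (k + 1) := by
  rw [stdTwist, Finset.sum_eq_single i]
  · simp
  · intro j _ hj
    simp [Pi.single_eq_of_ne hj]
  · simp

theorem stdTwist_single_lam (c : K) (i : Fin r) (k : ℕ) :
    stdTwist (Pi.single i c) 0 k =
      MvPolynomial.C (c * (k + 2)) * MvPolynomial.X i ^ (k + 1) := by
  rw [stdTwist, Finset.sum_eq_single i]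
  · simp [mul_comm]
  · intro j _ hj
    simp [Pi.single_eq_of_ne hj]
  · simp

/-- Leibniz rule: conjugation by `h` changes the twist by the logarithmic derivative `b` of `h`. -/
theorem twistedField_mul {a b : ℕ → MvPolynomial (Fin r) K} {h : MvPolynomial (Fin r) K}
    (hh : ∀ k, vectorField K r (k + 1) h = b k * h) (k : ℕ) (p : MvPolynomial (Fin r) K) :
    LinearMap.mulLeft K h (twistedField (a + b) k p) =
      twistedField a k (LinearMap.mulLeft K h p) := by
  simp only [LinearMap.mulLeft_apply, twistedField_apply, Derivation.leibniz, hh, smul_eq_mul,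
    Pi.add_apply]
  ring

theorem vectorField_X (k : ℕ) (i : Fin r) :
    vectorField K r k (MvPolynomial.X i) = MvPolynomial.X i ^ (k + 1) :=
  MvPolynomial.mkDerivation_X ..

theorem vectorField_X_sub (k : ℕ) (i j : Fin r) :
    vectorField K r (k + 1) (MvPolynomial.X i - MvPolynomial.X j) =
      dividedDiff (MvPolynomial.X i) (MvPolynomial.X j) k *
        (MvPolynomial.X i - MvPolynomial.X j) := by
  rw [dividedDiff_mul, map_sub, vectorField_X, vectorField_X]

/-- The only nonstandard generators are the divided differences with `i ≠ j`, which are the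
logarithmic derivatives of `z_i - z_j`. Logarithmic derivatives add when the polynomials `h` are
multiplied. -/
theorem exists_twist_eq_stdTwist_add {a : ℕ → MvPolynomial (Fin r) K} (ha : a ∈ twists K r) :
    ∃ (lam mu : Fin r → K) (b : ℕ → MvPolynomial (Fin r) K) (h : MvPolynomial (Fin r) K), h ≠ 0 ∧
      a = stdTwist lam mu + b ∧ ∀ k, vectorField K r (k + 1) h = b k * h := by
  induction ha using AddSubmonoid.closure_induction with
  | zero =>
    refine ⟨0, 0, 0, 1, one_ne_zero, ?_, by simp⟩
    funext k
    simp [stdTwist]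
  | add x y _ _ hx hy =>
    obtain ⟨l, m, b, h, h0, rfl, hb⟩ := hx
    obtain ⟨l', m', b', h', h0', rfl, hb'⟩ := hy
    refine ⟨l + l', m + m', b + b', h * h', mul_ne_zero h0 h0', ?_, fun k => ?_⟩
    · funext k
      simp only [Pi.add_apply, stdTwist_add]
      ring
    · simp only [Derivation.leibniz, hb, hb', smul_eq_mul, Pi.add_apply]
      ring
  | mem x hx =>
    cases hx with
    | weight c i =>
      exact ⟨0, Pi.single i c, 0, 1, one_ne_zero, by funext k; simp [stdTwist_single_mu], by simp⟩
    | density c i =>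
      exact ⟨Pi.single i c, 0, 0, 1, one_ne_zero, by funext k; simp [stdTwist_single_lam], by simp⟩
    | pair i j =>
      rcases eq_or_ne i j with rfl | hij
      -- On the diagonal the divided difference becomes the derivative of `x ^ (k + 2)`, which is
      -- the twist of `λ_i = 1`.
      · refine ⟨Pi.single i 1, 0, 0, 1, one_ne_zero, ?_, by simp⟩
        funext k
        simp only [Pi.add_apply, Pi.zero_apply, add_zero, stdTwist_single_lam, dividedDiff_self,
          one_mul]
        simp [show MvPolynomial.C (2 : K) = (2 : MvPolynomial (Fin r) K) from rfl]
      · refine ⟨0, 0, _, MvPolynomial.X i - MvPolynomial.X j, ?_, ?_,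
          fun k => vectorField_X_sub k i j⟩
        · exact sub_ne_zero.2 fun h => hij (MvPolynomial.X_injective h)
        · funext k
          simp [stdTwist]

theorem noeth_of_mem_twists (H : ∀ lam mu : Fin r → K, Noeth (twistedField (stdTwist lam mu)))
    {a : ℕ → MvPolynomial (Fin r) K} (ha : a ∈ twists K r) : Noeth (twistedField a) := by
  obtain ⟨lam, mu, b, h, h0, rfl, hb⟩ := exists_twist_eq_stdTwist_add ha
  exact (H lam mu).of_injective (φ := LinearMap.mulLeft K h) (twistedField_mul hb)
    fun p q hpq => mul_left_cancel₀ h0 hpq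

/-- The substitution of `q` for the variable number `i`. -/
noncomputable def substVar (i : Fin (n + 1)) (q : MvPolynomial (Fin n) K) :
    MvPolynomial (Fin (n + 1)) K →ₐ[K] MvPolynomial (Fin n) K :=
  MvPolynomial.aeval (Fin.insertNth i q MvPolynomial.X : Fin (n + 1) → MvPolynomial (Fin n) K)

/-- A polynomial that is a variable or zero. -/
def IsVarOrZero (q : MvPolynomial (Fin n) K) : Prop := q = 0 ∨ ∃ j, q = MvPolynomial.X j

theorem isVarOrZero_substVar (i : Fin (n + 1)) {q : MvPolynomial (Fin n) K} (hq : IsVarOrZero q)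
    (l : Fin (n + 1)) : IsVarOrZero (substVar i q (MvPolynomial.X l)) := by
  rw [substVar, MvPolynomial.aeval_X]
  induction l using i.succAboveCases with
  | x => simpa using hq
  | p j => exact .inr ⟨j, by simp⟩

/-- The locus `z_i = q` is invariant because `q`, being a variable or zero, is itself sent to `q ^
(k + 1)` by the field. -/
theorem substVar_vectorField (i : Fin (n + 1)) {q : MvPolynomial (Fin n) K} (hq : IsVarOrZero q) (k : ℕ)
    (p : MvPolynomial (Fin (n + 1)) K) :
    substVar i q (vectorField K (n + 1) k p) = vectorField K n k (substVar i q p) := by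
  induction p using MvPolynomial.induction_on with
  | C c => simp [MvPolynomial.algHom_C]
  | add p p' h h' => simp [h, h']
  | mul_X p l h =>
    have hl : vectorField K n k (substVar i q (MvPolynomial.X l)) =
        substVar i q (MvPolynomial.X l) ^ (k + 1) := by
      rcases isVarOrZero_substVar i hq l with h | ⟨j, h⟩
      · simp [h]
      · rw [h, vectorField_X]
    simp only [Derivation.leibniz, map_mul, map_add, smul_eq_mul, vectorField_X, h, hl, map_pow]

theorem substVar_mem_twists (i : Fin (n + 1)) {q : MvPolynomial (Fin n) K} (hq : IsVarOrZero q)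
    {a : ℕ → MvPolynomial (Fin (n + 1)) K} (ha : a ∈ twists K (n + 1)) :
    (fun k => substVar i q (a k)) ∈ twists K n := by
  have hzero : (fun _ => 0 : ℕ → MvPolynomial (Fin n) K) ∈ twists K n := zero_mem _
  induction ha using AddSubmonoid.closure_induction with
  | zero => simpa using hzero
  | add x y _ _ hx hy =>
    convert add_mem hx hy using 1
    funext k
    simp
  | mem x hx =>
    cases hx with
    | weight c l =>
      simp only [map_mul (substVar i q), map_pow, MvPolynomial.algHom_C, MvPolynomial.algebraMap_eq]
      rcases isVarOrZero_substVar i hq l with h | ⟨j, h⟩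
      · simpa [h] using hzero
      · simpa only [h] using twists_weight c j
    | density c l =>
      simp only [map_mul (substVar i q), map_pow, MvPolynomial.algHom_C, MvPolynomial.algebraMap_eq]
      rcases isVarOrZero_substVar i hq l with h | ⟨j, h⟩
      · simpa [h] using hzero
      · simpa only [h] using twists_density c j
    | pair l l' =>
      have key : (fun k => substVar i q (dividedDiff (MvPolynomial.X l) (MvPolynomial.X l') k)) =
          dividedDiff (substVar i q (MvPolynomial.X l)) (substVar i q (MvPolynomial.X l')) := by
        funext k
        simp only [dividedDiff, map_sum, map_mul, map_pow]
      rw [key]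
      have hw : ∀ j, (fun k => (MvPolynomial.X j : MvPolynomial (Fin n) K) ^ (k + 1)) ∈ twists K n :=
        fun j => by simpa using twists_weight (1 : K) j
      rcases isVarOrZero_substVar i hq l with h | ⟨j, h⟩ <;>
        rcases isVarOrZero_substVar i hq l' with h' | ⟨j', h'⟩ <;> rw [h, h']
      · convert zero_mem (twists K n) using 1
        funext k
        simp [dividedDiff_zero_left]
      · convert hw j' using 1
        exact _root_.funext (dividedDiff_zero_left _)
      · convert hw j using 1
        exact _root_.funext (dividedDiff_zero_right _)
      · exact twists_pair j j'

theorem sub_mem_span_of_substVar (i : Fin (n + 1)) (q : MvPolynomial (Fin n) K)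
    (p : MvPolynomial (Fin (n + 1)) K) :
    p - MvPolynomial.rename i.succAbove (substVar i q p) ∈
      Ideal.span {MvPolynomial.X i - MvPolynomial.rename i.succAbove q} := by
  induction p using MvPolynomial.induction_on with
  | C c => simp [MvPolynomial.algHom_C]
  | add p p' h h' =>
    rw [map_add, map_add, add_sub_add_comm]
    exact add_mem h h'
  | mul_X p l h =>
    have hl : MvPolynomial.X l - MvPolynomial.rename i.succAbove (substVar i q
        (MvPolynomial.X l)) ∈ Ideal.span
          {MvPolynomial.X i - MvPolynomial.rename i.succAbove q} := by
      rw [substVar, MvPolynomial.aeval_X]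
      induction l using i.succAboveCases with
      | x => simp
      | p j => simp
    rw [map_mul, map_mul, show ∀ x y z w : MvPolynomial (Fin (n + 1)) K,
      x * y - z * w = y * (x - z) + z * (y - w) from fun x y z w => by ring]
    exact add_mem (Ideal.mul_mem_left _ _ h) (Ideal.mul_mem_left _ _ hl)

theorem ker_substVar_le (i : Fin (n + 1)) (q : MvPolynomial (Fin n) K) :
    LinearMap.ker (substVar i q).toLinearMap ≤ LinearMap.range
      (LinearMap.mulLeft K (MvPolynomial.X i - MvPolynomial.rename i.succAbove q)) := by
  intro p hp
  have h := sub_mem_span_of_substVar i q p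
  rw [show substVar i q p = 0 from hp, map_zero, sub_zero] at h
  obtain ⟨b, rfl⟩ := Ideal.mem_span_singleton.1 h
  exact ⟨b, rfl⟩

/-- The linear forms cutting out the diagonals and the coordinate hyperplanes. -/
def linearFactors (K : Type*) [Field K] (r : ℕ) : Set (MvPolynomial (Fin r) K) :=
  {g | (∃ i, g = MvPolynomial.X i) ∨ ∃ i j, i ≠ j ∧ g = MvPolynomial.X i - MvPolynomial.X j}

theorem exists_weight_of_mem_linearFactors {g : MvPolynomial (Fin r) K} (hg : g ∈ linearFactors K r) :
    ∃ b ∈ twists K r, ∀ k, vectorField K r (k + 1) g = b k * g := by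
  rcases hg with ⟨i, rfl⟩ | ⟨i, j, -, rfl⟩
  · refine ⟨_, twists_weight 1 i, fun k => ?_⟩
    rw [vectorField_X, MvPolynomial.C_1, one_mul, ← pow_succ]
  · exact ⟨_, twists_pair i j, fun k => vectorField_X_sub k i j⟩

/-- The quotient by `g` embeds, through the substitution that solves `g = 0` for one variable, into
a twisted module in `n` variables, which is noetherian by `H`. -/
theorem noethMod_linearFactor
    (H : ∀ lam mu : Fin n → K, Noeth (twistedField (stdTwist lam mu)))
    {a : ℕ → MvPolynomial (Fin (n + 1)) K} (ha : a ∈ twists K (n + 1)) {g : MvPolynomial (Fin (n + 1)) K}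
    (hg : g ∈ linearFactors K (n + 1)) :
    NoethMod (twistedField a) (LinearMap.range (LinearMap.mulLeft K g)) := by
  obtain ⟨i, q, hq, rfl⟩ : ∃ (i : Fin (n + 1)) (q : MvPolynomial (Fin n) K), IsVarOrZero q ∧
      g = MvPolynomial.X i - MvPolynomial.rename i.succAbove q := by
    rcases hg with ⟨i, rfl⟩ | ⟨i, j, hij, rfl⟩
    · exact ⟨i, 0, .inl rfl, by simp⟩
    · obtain ⟨j, rfl⟩ := Fin.exists_succAbove_eq hij.symm
      exact ⟨i, MvPolynomial.X j, .inr ⟨j, rfl⟩, by simp⟩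
  refine NoethMod.mono ?_ (ker_substVar_le i q)
  refine (noeth_of_mem_twists H (substVar_mem_twists i hq ha)).noethMod_ker
    (φ := (substVar i q).toLinearMap) fun k p => ?_
  simp only [twistedField_apply, AlgHom.toLinearMap_apply, map_add, map_mul,
    substVar_vectorField i hq]

/-- Chains of stable subspaces stabilize modulo each linear factor. -/
def NoethModFactors (K : Type*) [Field K] (r : ℕ) : Prop :=
  ∀ a ∈ twists K r, ∀ g ∈ linearFactors K r,
    NoethMod (twistedField a) (LinearMap.range (LinearMap.mulLeft K g))

/-- Dividing by a factor `g` replaces the twist by its sum with the logarithmic derivative of `g`,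
which is again in `twists`. This is why the claim ranges over all twists. -/
theorem NoethModFactors.mul (H : NoethModFactors K r) {h : MvPolynomial (Fin r) K}
    (hh : h ∈ Submonoid.closure (linearFactors K r)) :
    ∀ a ∈ twists K r, NoethMod (twistedField a) (LinearMap.range (LinearMap.mulLeft K h)) := by
  induction hh using Submonoid.closure_induction_left with
  | one =>
    intro a _
    rw [LinearMap.mulLeft_one, LinearMap.range_id]
    exact noethMod_top _
  | mul_left g hg h _ ih =>
    intro a ha
    obtain ⟨b, hb, hgb⟩ := exists_weight_of_mem_linearFactors hg
    have := NoethMod.extend (twistedField_mul hgb) (H a ha g hg) (ih (a + b) (add_mem ha hb))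
    rwa [← LinearMap.range_comp, ← LinearMap.mulLeft_mul] at this

end Operators

/-! ### Diagonal operators as differential operators -/

section Diagonal

variable {K : Type*} [Field K] {σ τ : Type*}

/-- The operator which multiplies the monomial with exponent `m` by `F m`. -/
noncomputable def diagOp (F : (σ →₀ ℕ) → K) : Module.End K (MvPolynomial σ K) :=
  (MvPolynomial.basisMonomials σ K).constr K fun m => MvPolynomial.monomial m (F m)

@[simp]
theorem diagOp_monomial (F : (σ →₀ ℕ) → K) (m : σ →₀ ℕ) (c : K) :
    diagOp F (MvPolynomial.monomial m c) = MvPolynomial.monomial m (F m * c) := by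
  have h : (MvPolynomial.monomial m c : MvPolynomial σ K) =
      c • MvPolynomial.basisMonomials σ K m := by
    simp [MvPolynomial.smul_monomial]
  rw [h, map_smul, diagOp, Module.Basis.constr_basis, MvPolynomial.smul_monomial, smul_eq_mul,
    mul_comm]

theorem diagOp_mul (F G : (σ →₀ ℕ) → K) (p : MvPolynomial σ K) :
    diagOp (fun m => F m * G m) p = diagOp F (diagOp G p) := by
  induction p using MvPolynomial.induction_on' with
  | monomial m c => simp [mul_assoc]
  | add p q hp hq => simp only [map_add, hp, hq]

theorem diagOp_one (p : MvPolynomial σ K) : diagOp (fun _ => 1) p = p := by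
  induction p using MvPolynomial.induction_on' with
  | monomial m c => simp
  | add p q hp hq => simp only [map_add, hp, hq]

theorem coeff_diagOp (F : (σ →₀ ℕ) → K) (p : MvPolynomial σ K) (m : σ →₀ ℕ) :
    (diagOp F p).coeff m = F m * p.coeff m := by
  classical
  induction p using MvPolynomial.induction_on' with
  | monomial m' c =>
    simp only [diagOp_monomial, MvPolynomial.coeff_monomial]
    split_ifs with h
    · rw [h]
    · simp
  | add p q hp hq => simp only [map_add, MvPolynomial.coeff_add, hp, hq, mul_add]

/-- An affine function of the exponents. -/
def affineWeight [Fintype σ] (w : σ → K) (κ : K) (m : σ →₀ ℕ) : K := ∑ v, (m v : K) * w v + κ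

/-- The derivation `∑ v, w v • z_v ∂_v`. -/
noncomputable def eulerDer (w : σ → K) :
    Derivation K (MvPolynomial σ K) (MvPolynomial σ K) :=
  MvPolynomial.mkDerivation K fun v => w v • MvPolynomial.X v

theorem eulerDer_X (w : σ → K) (v : σ) :
    eulerDer w (MvPolynomial.X v) = w v • MvPolynomial.X v :=
  MvPolynomial.mkDerivation_X ..

variable [Fintype σ]

theorem eulerDer_monomial (w : σ → K) (m : σ →₀ ℕ) (c : K) :
    eulerDer w (MvPolynomial.monomial m c) =
      MvPolynomial.monomial m ((∑ v, (m v : K) * w v) * c) := by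
  rw [eulerDer, MvPolynomial.mkDerivation_monomial, Finsupp.sum_fintype _ _ (by simp),
    Finset.sum_mul, map_sum, Finset.smul_sum]
  refine Finset.sum_congr rfl fun v _ => ?_
  rcases Nat.eq_zero_or_pos (m v) with h | h
  · simp [h]
  · rw [smul_eq_mul, mul_smul_comm, MvPolynomial.X, MvPolynomial.monomial_mul,
      Finsupp.sub_add_single_one_cancel h.ne', MvPolynomial.smul_monomial,
      MvPolynomial.smul_monomial]
    congr 1
    simp only [smul_eq_mul]
    ring

/-- Affine weights are first-order differential operators, so a product of `d` of them has order at
most `d`. -/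
theorem diagOp_affineWeight (w : σ → K) (κ : K) (p : MvPolynomial σ K) :
    diagOp (affineWeight w κ) p = eulerDer w p + κ • p := by
  induction p using MvPolynomial.induction_on' with
  | monomial m c =>
    rw [diagOp_monomial, eulerDer_monomial, MvPolynomial.smul_monomial, ← map_add, affineWeight,
      add_mul, smul_eq_mul]
  | add p q hp hq =>
    simp only [map_add, hp, hq, smul_add]
    abel

theorem diagOp_affineWeight_mul (w : σ → K) (κ : K) (p q : MvPolynomial σ K) :
    diagOp (affineWeight w κ) (p * q) = eulerDer w p * q + p * diagOp (affineWeight w κ) q := by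
  rw [diagOp_affineWeight, diagOp_affineWeight, Derivation.leibniz, mul_add, mul_smul_comm,
    smul_eq_mul, smul_eq_mul]
  ring

variable {B ι : Type*} [CommRing B] [Algebra K B]

/-- Each first-order factor lowers the power of `u` by at most one. Modulo `u`, only the terms in
which every factor differentiates a power of `u` survive, giving the principal symbol times a
quotient of factorials. -/
theorem exists_diagOp_prod_pow_mul [DecidableEq ι] (s : Finset ι) (w : ι → σ → K) (κ : ι → K)
    (ev : MvPolynomial σ K →ₐ[K] B) {u : MvPolynomial σ K} (hu : ev u = 0)
    (v : MvPolynomial σ K) (M : ℕ) :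
    ∃ v', diagOp (fun m => ∏ k ∈ s, affineWeight (w k) (κ k) m) (u ^ (s.card + M) * v) =
        u ^ M * v' ∧
      (M.factorial : B) * ev v' =
        ((s.card + M).factorial : B) * (∏ k ∈ s, ev (eulerDer (w k) u)) * ev v := by
  induction s using Finset.induction_on generalizing M with
  | empty => exact ⟨v, by simp [diagOp_one], by simp⟩
  | insert k s hk ih =>
    obtain ⟨v', h₁, h₂⟩ := ih (M + 1)
    refine ⟨(M + 1 : ℕ) * eulerDer (w k) u * v' + u * diagOp (affineWeight (w k) (κ k)) v', ?_, ?_⟩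
    · simp only [Finset.prod_insert hk]
      rw [diagOp_mul, Finset.card_insert_of_notMem hk, add_assoc, add_comm 1 M, h₁,
        diagOp_affineWeight_mul, Derivation.leibniz_pow]
      simp only [Nat.add_sub_cancel, nsmul_eq_mul, smul_eq_mul]
      ring
    · rw [Finset.prod_insert hk, Finset.card_insert_of_notMem hk, add_assoc, add_comm 1 M]
      have : ((M + 1).factorial : B) = (M.factorial : B) * (M + 1 : ℕ) := by
        rw [Nat.factorial_succ, Nat.cast_mul, mul_comm]
      rw [this] at h₂
      simp only [map_add, map_mul, hu, map_natCast, zero_mul, add_zero]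
      linear_combination ev (eulerDer (w k) u) * h₂

theorem map_diagOp_prod_pow_mul_eq_zero [DecidableEq ι] {s : Finset ι} {w : ι → σ → K}
    {κ : ι → K} {ev : MvPolynomial σ K →ₐ[K] B} {u v : MvPolynomial σ K} (hu : ev u = 0) {N : ℕ}
    (hN : s.card < N) :
    ev (diagOp (fun m => ∏ k ∈ s, affineWeight (w k) (κ k) m) (u ^ N * v)) = 0 := by
  obtain ⟨M, rfl⟩ := Nat.exists_eq_add_of_lt hN
  obtain ⟨v', h, -⟩ := exists_diagOp_prod_pow_mul s w κ ev hu v (M + 1)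
  rw [add_assoc, h, map_mul, map_pow, hu, zero_pow (by omega), zero_mul]

theorem map_diagOp_prod_pow_mul [DecidableEq ι] {s : Finset ι} {w : ι → σ → K}
    {κ : ι → K} {ev : MvPolynomial σ K →ₐ[K] B} {u v : MvPolynomial σ K} (hu : ev u = 0) :
    ev (diagOp (fun m => ∏ k ∈ s, affineWeight (w k) (κ k) m) (u ^ s.card * v)) =
      (s.card.factorial : B) * (∏ k ∈ s, ev (eulerDer (w k) u)) * ev v := by
  obtain ⟨v', h, h'⟩ := exists_diagOp_prod_pow_mul s w κ ev hu v 0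
  simp only [add_zero, pow_zero, one_mul, Nat.factorial_zero, Nat.cast_one] at h h'
  rw [h, h']

end Diagonal

/-! ### Bilinear operations with auxiliary coefficient variables -/

section Outer

variable {K : Type*} [Field K] {α β γ : Type*}

/-- The product of two polynomials in disjoint sets of variables. -/
noncomputable def outer (c : MvPolynomial α K) (g : MvPolynomial β K) : MvPolynomial (α ⊕ β) K :=
  MvPolynomial.rename Sum.inl c * MvPolynomial.rename Sum.inr g

theorem outer_add_left (c c' : MvPolynomial α K) (g : MvPolynomial β K) :
    outer (c + c') g = outer c g + outer c' g := by
  simp only [outer, map_add, add_mul]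

theorem outer_add_right (c : MvPolynomial α K) (g g' : MvPolynomial β K) :
    outer c (g + g') = outer c g + outer c g' := by
  simp only [outer, map_add, mul_add]

theorem outer_monomial (a : α →₀ ℕ) (m : β →₀ ℕ) (x y : K) :
    outer (MvPolynomial.monomial a x) (MvPolynomial.monomial m y) =
      MvPolynomial.monomial (Finsupp.sumElim a m) (x * y) := by
  classical
  rw [outer, MvPolynomial.rename_monomial, MvPolynomial.rename_monomial,
    MvPolynomial.monomial_mul]
  congr 1
  congr 1
  ext v
  rcases v with v | v
  · simp [Finsupp.mapDomain_apply Sum.inl_injective, Finsupp.mapDomain_of_notMem_range]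
  · simp [Finsupp.mapDomain_apply Sum.inr_injective, Finsupp.mapDomain_of_notMem_range]

theorem mapDomain_sumElim (φ : α → β) (a : α →₀ ℕ) (m : β →₀ ℕ) :
    (Finsupp.sumElim a m).mapDomain (Sum.elim φ id) = a.mapDomain φ + m := by
  have : Finsupp.sumElim a m = a.mapDomain Sum.inl + m.mapDomain Sum.inr := by
    ext v
    rcases v with v | v
    · simp [Finsupp.mapDomain_apply Sum.inl_injective, Finsupp.mapDomain_of_notMem_range]
    · simp [Finsupp.mapDomain_apply Sum.inr_injective, Finsupp.mapDomain_of_notMem_range]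
  rw [this, Finsupp.mapDomain_add, ← Finsupp.mapDomain_comp, ← Finsupp.mapDomain_comp]
  simp

/-- A weight that ignores the exponents of the first factor acts linearly over that factor. -/
theorem diagOp_rename_mul_rename (f : α → γ) (h : β → γ) (F : (β →₀ ℕ) → K) (G : (γ →₀ ℕ) → K)
    (hG : ∀ (a : α →₀ ℕ) (m : β →₀ ℕ), G (a.mapDomain f + m.mapDomain h) = F m) (c : MvPolynomial α K)
    (g : MvPolynomial β K) :
    diagOp G (MvPolynomial.rename f c * MvPolynomial.rename h g) =
      MvPolynomial.rename f c * MvPolynomial.rename h (diagOp F g) := by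
  induction c using MvPolynomial.induction_on' with
  | add c c' h h' => simp only [add_mul, map_add, h, h']
  | monomial a x =>
    induction g using MvPolynomial.induction_on' with
    | add g g' h h' => simp only [mul_add, map_add, h, h']
    | monomial m y =>
      simp only [MvPolynomial.rename_monomial, MvPolynomial.monomial_mul, diagOp_monomial, hG]
      congr 1
      ring

/-- The bilinear operation which multiplies `x ^ a` and `z ^ m` after the substitution `φ` of
variables, and after the rescaling of their product by `F`. -/
noncomputable def symbolOp (φ : α → β) (F : (α ⊕ β →₀ ℕ) → K) (c : MvPolynomial α K)
    (g : MvPolynomial β K) : MvPolynomial β K :=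
  MvPolynomial.rename (Sum.elim φ id) (diagOp F (outer c g))

theorem symbolOp_add_left (φ : α → β) (F : (α ⊕ β →₀ ℕ) → K) (c c' : MvPolynomial α K)
    (g : MvPolynomial β K) : symbolOp φ F (c + c') g = symbolOp φ F c g + symbolOp φ F c' g := by
  simp only [symbolOp, outer_add_left, map_add]

theorem symbolOp_add_right (φ : α → β) (F : (α ⊕ β →₀ ℕ) → K) (c : MvPolynomial α K)
    (g g' : MvPolynomial β K) : symbolOp φ F c (g + g') = symbolOp φ F c g + symbolOp φ F c g' := by
  simp only [symbolOp, outer_add_right, map_add]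

theorem symbolOp_monomial (φ : α → β) (F : (α ⊕ β →₀ ℕ) → K) (a : α →₀ ℕ) (m : β →₀ ℕ)
    (x y : K) :
    symbolOp φ F (MvPolynomial.monomial a x) (MvPolynomial.monomial m y) =
      MvPolynomial.monomial (a.mapDomain φ + m) (F (Finsupp.sumElim a m) * (x * y)) := by
  rw [symbolOp, outer_monomial, diagOp_monomial, MvPolynomial.rename_monomial, mapDomain_sumElim]

theorem symbolOp_rename (φ : γ → α) (F : (α ⊕ β →₀ ℕ) → K) (ψ : α → β)
    (G : (γ ⊕ β →₀ ℕ) → K)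
    (hG : ∀ a m, G (Finsupp.sumElim a m) = F (Finsupp.sumElim (a.mapDomain φ) m))
    (c : MvPolynomial γ K) (g : MvPolynomial β K) :
    symbolOp ψ F (MvPolynomial.rename φ c) g = symbolOp (ψ ∘ φ) G c g := by
  induction c using MvPolynomial.induction_on' with
  | add c c' h h' => simp only [symbolOp_add_left, map_add, h, h']
  | monomial a x =>
    induction g using MvPolynomial.induction_on' with
    | add g g' h h' => simp only [symbolOp_add_right, h, h']
    | monomial m y =>
      rw [MvPolynomial.rename_monomial, symbolOp_monomial, symbolOp_monomial, hG,
        Finsupp.mapDomain_comp]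

end Outer

/-! ### Words in the fields and their symmetrized combinations -/

section Words

variable {K : Type*} [Field K] {r p : ℕ}

/-- The operator `∑ i, z_i ^ k (z_i ∂_i + μ_i + (k + 1) λ_i)`. -/
noncomputable def fieldOp (lam mu : Fin r → K) (k : ℕ) : Module.End K (MvPolynomial (Fin r) K) :=
  (vectorField K r k : MvPolynomial (Fin r) K →ₗ[K] MvPolynomial (Fin r) K) +
    LinearMap.mulLeft K
      (∑ i, MvPolynomial.C (mu i + (k + 1) * lam i) * MvPolynomial.X i ^ k)

theorem fieldOp_succ (lam mu : Fin r → K) (k : ℕ) :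
    fieldOp lam mu (k + 1) = twistedField (stdTwist lam mu) k := by
  have h : ∑ i, MvPolynomial.C (mu i + (((k + 1 : ℕ) : K) + 1) * lam i) *
      MvPolynomial.X i ^ (k + 1) = stdTwist lam mu k := by
    refine Finset.sum_congr rfl fun i _ => ?_
    congr 2
    push_cast
    ring
  rw [fieldOp, twistedField, h]

theorem fieldOp_monomial (lam mu : Fin r → K) (k : ℕ) (m : Fin r →₀ ℕ) (c : K) :
    fieldOp lam mu k (MvPolynomial.monomial m c) =
      ∑ i, MvPolynomial.monomial (m + Finsupp.single i k)
        ((m i + mu i + (k + 1) * lam i) * c) := by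
  rw [fieldOp, LinearMap.add_apply, LinearMap.mulLeft_apply, Finset.sum_mul, vectorField]
  change MvPolynomial.mkDerivation K _ _ + _ = _
  rw [MvPolynomial.mkDerivation_monomial, Finsupp.sum_fintype _ _ (by simp), Finset.smul_sum,
    ← Finset.sum_add_distrib]
  refine Finset.sum_congr rfl fun i _ => ?_
  rw [MvPolynomial.X_pow_eq_monomial, MvPolynomial.X_pow_eq_monomial, MvPolynomial.C_mul_monomial,
    MvPolynomial.monomial_mul, smul_eq_mul, MvPolynomial.monomial_mul,
    MvPolynomial.smul_monomial, smul_eq_mul, mul_one, mul_one, add_comm (Finsupp.single i k) m]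
  rcases Nat.eq_zero_or_pos (m i) with h | h
  · simp [h]
  · have hm : m - Finsupp.single i 1 + Finsupp.single i (k + 1) = m + Finsupp.single i k := by
      rw [add_comm k 1, Finsupp.single_add, ← add_assoc,
        Finsupp.sub_add_single_one_cancel h.ne']
    rw [hm, ← map_add]
    congr 1
    ring

/-- The composition of the operators `fieldOp lam mu (a j)`. -/
noncomputable def word (lam mu : Fin r → K) (a : Fin p → ℕ) :
    Module.End K (MvPolynomial (Fin r) K) :=
  (List.ofFn fun j => fieldOp lam mu (a j)).prod

/-- The contribution to a word of the terms in which the factor number `j` acts on the variable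
number `φ j`. -/
def wordWeight (lam mu : Fin r → K) (φ : Fin p → Fin r) (a : Fin p → ℕ) (m : Fin r → ℕ) : K :=
  ∏ j, (m (φ j) + ∑ l, (if j < l ∧ φ l = φ j then (a l : K) else 0) + mu (φ j) +
    (a j + 1) * lam (φ j))

/-- Letters act from the right, so letter `j` sees the exponent of its variable already raised by
the letters `l > j` with `φ l = φ j`. -/
theorem word_monomial (lam mu : Fin r → K) (a : Fin p → ℕ) (m : Fin r →₀ ℕ) (c : K) :
    word lam mu a (MvPolynomial.monomial m c) =
      ∑ φ : Fin p → Fin r, MvPolynomial.monomial (m + ∑ j, Finsupp.single (φ j) (a j))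
        (wordWeight lam mu φ a m * c) := by
  induction p with
  | zero => simp [word, wordWeight]
  | succ p ih =>
    have hw : word lam mu a = fieldOp lam mu (a 0) * word lam mu (fun j => a j.succ) := by
      simp [word, List.ofFn_succ]
    rw [hw, Module.End.mul_apply, ih, map_sum,
      ← (Fin.consEquiv fun _ : Fin (p + 1) => Fin r).sum_comp, Fintype.sum_prod_type,
      Finset.sum_comm]
    refine Finset.sum_congr rfl fun φ _ => ?_
    rw [fieldOp_monomial]
    refine Finset.sum_congr rfl fun i _ => ?_
    have h1 : (((m + ∑ j, Finsupp.single (φ j) (a j.succ) : Fin r →₀ ℕ) i : ℕ) : K) =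
        m i + ∑ l, if φ l = i then (a l.succ : K) else 0 := by
      simp [Finsupp.single_apply]
    rw [h1]
    congr 1
    · simp only [Fin.consEquiv_apply, Fin.sum_univ_succ, Fin.cons_zero, Fin.cons_succ]
      rw [add_assoc, add_comm (Finsupp.single i (a 0))]
    · simp only [wordWeight, Fin.consEquiv_apply, Fin.prod_univ_succ, Fin.sum_univ_succ,
        Fin.cons_zero, Fin.cons_succ, Fin.succ_lt_succ_iff, Fin.succ_pos,
        false_and, true_and, if_false, zero_add, Fin.not_lt_zero, mul_assoc]

/-- The combination of words with the coefficients of a polynomial. -/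
noncomputable def wordComb (lam mu : Fin r → K) :
    MvPolynomial (Fin p) K →ₗ[K] Module.End K (MvPolynomial (Fin r) K) :=
  (MvPolynomial.basisMonomials (Fin p) K).constr K fun a => word lam mu a

theorem wordComb_monomial (lam mu : Fin r → K) (a : Fin p →₀ ℕ) (c : K) :
    wordComb lam mu (MvPolynomial.monomial a c) = c • word lam mu a := by
  have h : (MvPolynomial.monomial a c : MvPolynomial (Fin p) K) =
      c • MvPolynomial.basisMonomials (Fin p) K a := by
    simp [MvPolynomial.smul_monomial]
  rw [h, map_smul, wordComb, Module.Basis.constr_basis]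

theorem mapDomain_eq_sum_single {α β : Type*} [Fintype α] (φ : α → β) (a : α →₀ ℕ) :
    a.mapDomain φ = ∑ j, Finsupp.single (φ j) (a j) :=
  Finsupp.sum_fintype _ _ (by simp)

theorem wordComb_apply (lam mu : Fin r → K) (c : MvPolynomial (Fin p) K)
    (g : MvPolynomial (Fin r) K) :
    wordComb lam mu c g = ∑ φ : Fin p → Fin r, symbolOp φ
      (fun e => wordWeight lam mu φ (fun j => e (.inl j)) fun i => e (.inr i)) c g := by
  induction c using MvPolynomial.induction_on' with
  | add c c' h h' =>
    simp only [symbolOp_add_left, map_add, LinearMap.add_apply, h, h', Finset.sum_add_distrib]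
  | monomial a x =>
    induction g using MvPolynomial.induction_on' with
    | add g g' h h' => simp only [symbolOp_add_right, map_add, h, h', Finset.sum_add_distrib]
    | monomial m y =>
      rw [wordComb_monomial, LinearMap.smul_apply, word_monomial, Finset.smul_sum]
      refine Finset.sum_congr rfl fun φ _ => ?_
      rw [symbolOp_monomial, MvPolynomial.smul_monomial, mapDomain_eq_sum_single, add_comm m]
      congr 1
      simp only [Finsupp.sumElim_inl, Finsupp.sumElim_inr, smul_eq_mul]
      ring

/-- The factor `∏ X_j` makes all exponents at least one, which excludes `fieldOp lam mu 0`, an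
operator not coming from `L₁`. -/
theorem wordComb_mem {lam mu : Fin r → K} {N : Submodule K (MvPolynomial (Fin r) K)}
    (hN : IsStable (twistedField (stdTwist lam mu)) N) {g : MvPolynomial (Fin r) K} (hg : g ∈ N)
    (c : MvPolynomial (Fin p) K) : wordComb lam mu ((∏ j, MvPolynomial.X j) * c) g ∈ N := by
  induction c using MvPolynomial.induction_on' with
  | add c c' h h' =>
    rw [mul_add, map_add]
    exact add_mem h h'
  | monomial a x =>
    have hX : (∏ j : Fin p, MvPolynomial.X j : MvPolynomial (Fin p) K) =
        MvPolynomial.monomial (∑ j, Finsupp.single j 1) 1 := by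
      rw [MvPolynomial.monomial_sum_one]
      rfl
    rw [hX, MvPolynomial.monomial_mul, wordComb_monomial]
    refine N.smul_mem _ ?_
    have key : ∀ l : List (Module.End K (MvPolynomial (Fin r) K)),
        (∀ T ∈ l, ∀ x ∈ N, T x ∈ N) → l.prod g ∈ N := by
      intro l hl
      induction l with
      | nil => simpa using hg
      | cons T l ih =>
        rw [List.prod_cons]
        exact hl T (by simp) _ (ih fun T' hT' => hl T' (by simp [hT']))
    refine key _ fun T hT => ?_
    obtain ⟨j, rfl⟩ := List.mem_ofFn.1 hT
    have hj : (∑ i, Finsupp.single i 1 + a : Fin p →₀ ℕ) j = a j + 1 := by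
      simp [Finsupp.single_apply, add_comm]
    simp only [hj, fieldOp_succ]
    exact hN _

/-- The polynomial `∏ i, z_i ∏ i ≠ j, (z_i - z_j) ^ (r + 1)`. -/
noncomputable def discFactor (K : Type*) [Field K] (r : ℕ) : MvPolynomial (Fin r) K :=
  (∏ i, MvPolynomial.X i) * ∏ i, ∏ j, if i = j then 1 else
    (MvPolynomial.X i - MvPolynomial.X j) ^ (r + 1)

theorem discFactor_mem : discFactor K r ∈ Submonoid.closure (linearFactors K r) := by
  refine mul_mem (prod_mem fun i _ => Submonoid.subset_closure (.inl ⟨i, rfl⟩))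
    (prod_mem fun i _ => prod_mem fun j _ => ?_)
  split_ifs with h
  · exact one_mem _
  · exact pow_mem (Submonoid.subset_closure (.inr ⟨i, j, h, rfl⟩)) _

theorem discFactor_isSymmetric : (discFactor K r).IsSymmetric := by
  intro e
  simp only [discFactor, map_mul, map_prod, MvPolynomial.rename_X, apply_ite, map_one, map_pow,
    map_sub]
  congr 1
  · exact Equiv.prod_comp e fun i => (MvPolynomial.X i : MvPolynomial (Fin r) K)
  · refine (Finset.prod_congr rfl fun i _ => ?_).trans (Equiv.prod_comp e fun i => ∏ j,
      if i = j then (1 : MvPolynomial (Fin r) K) else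
        (MvPolynomial.X i - MvPolynomial.X j) ^ (r + 1))
    refine Eq.trans ?_ (Equiv.prod_comp e _)
    simp

theorem discFactor_dvd {i j : Fin r} (h : i ≠ j) :
    (MvPolynomial.X i - MvPolynomial.X j) ^ (r + 1) ∣ discFactor K r := by
  have h₁ := Finset.dvd_prod_of_mem (fun j => if i = j then (1 : MvPolynomial (Fin r) K) else
    (MvPolynomial.X i - MvPolynomial.X j) ^ (r + 1)) (Finset.mem_univ j)
  have h₂ := Finset.dvd_prod_of_mem (fun i => ∏ j, if i = j then (1 : MvPolynomial (Fin r) K) else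
    (MvPolynomial.X i - MvPolynomial.X j) ^ (r + 1)) (Finset.mem_univ i)
  rw [if_neg h] at h₁
  exact (h₁.trans h₂).mul_left _

/-- The exponent function of the operation `diagSymbol`. -/
def diagWeight (lam mu : Fin r → K) (e : Fin r ⊕ Fin r →₀ ℕ) : K :=
  ∏ i, (e (.inr i) + mu i + (e (.inl i) + 1) * lam i)

/-- The operation given by `∏ i, (z_i ∂_i + μ_i + λ_i + λ_i θ_i)`, where `θ_i` is the operator
`z_i ∂_i` on the coefficient. -/
noncomputable def diagSymbol (lam mu : Fin r → K) (c g : MvPolynomial (Fin r) K) :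
    MvPolynomial (Fin r) K :=
  symbolOp id (diagWeight lam mu) c g

/-- The weight is a product of `r` affine functions, an operator of order at most `r`. It cannot
remove all `r + 1` factors `x_i - x_j`, and `φ` identifies `x_i` with `x_j`. -/
theorem symbolOp_wordWeight_of_not_injective (lam mu : Fin r → K) {φ : Fin r → Fin r}
    (hφ : ¬ Function.Injective φ) (c g : MvPolynomial (Fin r) K) :
    symbolOp φ (fun e => wordWeight lam mu φ (fun j => e (.inl j)) fun i => e (.inr i))
      (discFactor K r * c) g = 0 := by
  obtain ⟨i, j, hij, hne⟩ : ∃ i j, φ i = φ j ∧ i ≠ j := by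
    simpa [Function.Injective] using hφ
  obtain ⟨d, hd⟩ := discFactor_dvd (K := K) hne
  set w : Fin r → Fin r ⊕ Fin r → K := fun j => Sum.elim
    (fun l => (if j < l ∧ φ l = φ j then 1 else 0) + if l = j then lam (φ j) else 0)
    (fun i => if i = φ j then 1 else 0)
  have hF : (fun e : Fin r ⊕ Fin r →₀ ℕ =>
      wordWeight lam mu φ (fun j => e (.inl j)) fun i => e (.inr i)) =
      fun e => ∏ j, affineWeight (w j) (mu (φ j) + lam (φ j)) e := by
    funext e
    refine Finset.prod_congr rfl fun j _ => ?_
    simp only [affineWeight, w, Fintype.sum_sum_type, Sum.elim_inl, Sum.elim_inr, mul_add,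
      Finset.sum_add_distrib, mul_ite, mul_one, mul_zero, Finset.sum_ite_eq', Finset.mem_univ,
      if_true]
    ring
  have hv : outer (discFactor K r * c) g =
      (MvPolynomial.X (.inl i) - MvPolynomial.X (.inl j)) ^ (r + 1) * outer (d * c) g := by
    rw [hd]
    simp only [outer, map_mul, map_pow, map_sub, MvPolynomial.rename_X]
    ring
  rw [symbolOp, hF, hv]
  exact map_diagOp_prod_pow_mul_eq_zero (by simp [hij]) (by simp)

/-- No two letters act on the same variable, so the interaction terms of the weight vanish and `φ`
only relabels the coefficient variables. -/
theorem symbolOp_wordWeight_of_bijective (lam mu : Fin r → K) (φ : Equiv.Perm (Fin r))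
    (c g : MvPolynomial (Fin r) K) :
    symbolOp φ (fun e => wordWeight lam mu φ (fun j => e (.inl j)) fun i => e (.inr i)) c g =
      diagSymbol lam mu (MvPolynomial.rename φ c) g := by
  rw [diagSymbol, symbolOp_rename (φ : Fin r → Fin r)]
  · rfl
  · intro a m
    rw [diagWeight, wordWeight]
    refine Eq.trans ?_ (Equiv.prod_comp φ _)
    refine Finset.prod_congr rfl fun j _ => ?_
    have h : (∑ l, if j < l ∧ φ l = φ j then (Finsupp.sumElim a m (.inl l) : K) else 0) = 0 := by
      refine Finset.sum_eq_zero fun l _ => if_neg ?_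
      rintro ⟨h, h'⟩
      exact h.ne' (φ.injective h')
    rw [h]
    simp [Finsupp.mapDomain_apply φ.injective]

theorem diagSymbol_mem [CharZero K] {lam mu : Fin r → K}
    {N : Submodule K (MvPolynomial (Fin r) K)}
    (hN : IsStable (twistedField (stdTwist lam mu)) N) {g : MvPolynomial (Fin r) K} (hg : g ∈ N)
    {t : MvPolynomial (Fin r) K} (ht : t.IsSymmetric) :
    diagSymbol lam mu (discFactor K r * t) g ∈ N := by
  have h : wordComb lam mu (discFactor K r * t) g ∈ N := by
    rw [discFactor, mul_assoc]
    exact wordComb_mem hN hg _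
  have h' : wordComb lam mu (discFactor K r * t) g =
      ∑ φ : Fin r → Fin r, if Function.Injective φ then
        diagSymbol lam mu (discFactor K r * t) g else 0 := by
    rw [wordComb_apply]
    refine Finset.sum_congr rfl fun φ _ => ?_
    split_ifs with hφ
    · have := symbolOp_wordWeight_of_bijective lam mu
        (Equiv.ofBijective φ (Finite.injective_iff_bijective.1 hφ)) (discFactor K r * t) g
      rwa [(discFactor_isSymmetric.mul ht) _] at this
    · exact symbolOp_wordWeight_of_not_injective lam mu hφ t g
  rw [← Finset.sum_filter, Finset.sum_const] at h'
  set n := (Finset.univ.filter fun φ : Fin r → Fin r => Function.Injective φ).card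
  -- All injective maps contribute the same term, so their number must be inverted: characteristic
  -- zero is used here.
  have hn : (n : K) ≠ 0 := by
    refine Nat.cast_ne_zero.2 (Finset.card_ne_zero.2 ⟨id, ?_⟩)
    simp [Function.injective_id]
  rw [h', ← Nat.cast_smul_eq_nsmul K] at h
  exact (N.smul_mem_iff hn).1 h

end Words

/-! ### Leading part of a composition of two operations -/

section Quadratic

variable {K : Type*} [Field K] {r : ℕ}

/-- The operator `∏ i, (z_i ∂_i + μ_i)` over the indices with `λ_i = 0`. -/
noncomputable def zeroOp (lam mu : Fin r → K) : Module.End K (MvPolynomial (Fin r) K) :=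
  open scoped Classical in diagOp fun m => ∏ i with lam i = 0, ((m i : K) + mu i)

/-- The weight of the composition of two operations `diagSymbol`. -/
def diagWeight₂ (lam mu : Fin r → K) (e : Fin r ⊕ (Fin r ⊕ Fin r) →₀ ℕ) : K :=
  (∏ i, (e (.inr (.inr i)) + e (.inr (.inl i)) + mu i + (e (.inl i) + 1) * lam i)) *
    ∏ i, (e (.inr (.inr i)) + mu i + (e (.inr (.inl i)) + 1) * lam i)

/-- The identification of three sets of variables. -/
noncomputable def fold (K : Type*) [Field K] (r : ℕ) :
    MvPolynomial (Fin r ⊕ (Fin r ⊕ Fin r)) K →ₐ[K] MvPolynomial (Fin r) K :=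
  MvPolynomial.rename (Sum.elim id (Sum.elim id id))

theorem fold_outer (c c' g : MvPolynomial (Fin r) K) :
    fold K r (outer c (outer c' g)) = c * (c' * g) := by
  simp only [fold, outer, map_mul, MvPolynomial.rename_rename]
  exact congr_arg₂ _ (MvPolynomial.rename_id_apply c)
    (congr_arg₂ _ (MvPolynomial.rename_id_apply c') (MvPolynomial.rename_id_apply g))

theorem diagSymbol_diagSymbol (lam mu : Fin r → K) (c c' g : MvPolynomial (Fin r) K) :
    diagSymbol lam mu c (diagSymbol lam mu c' g) =
      fold K r (diagOp (diagWeight₂ lam mu) (outer c (outer c' g))) := by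
  induction c using MvPolynomial.induction_on' with
  | add c₁ c₂ h h' =>
    simp only [diagSymbol] at h h' ⊢
    simp only [symbolOp_add_left, outer_add_left, map_add, h, h']
  | monomial a x =>
    induction c' using MvPolynomial.induction_on' with
    | add c₁ c₂ h h' =>
      simp only [diagSymbol] at h h' ⊢
      simp only [symbolOp_add_left, symbolOp_add_right, outer_add_left, outer_add_right, map_add,
        h, h']
    | monomial b y =>
      induction g using MvPolynomial.induction_on' with
      | add c₁ c₂ h h' =>
        simp only [diagSymbol] at h h' ⊢
        simp only [symbolOp_add_right, outer_add_right, map_add, h, h']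
      | monomial m z =>
        have he : (Finsupp.sumElim a (Finsupp.sumElim b m)).mapDomain
            (Sum.elim id (Sum.elim id id)) = a + (b + m) := by
          rw [mapDomain_eq_sum_single]
          simp only [Fintype.sum_sum_type, Sum.elim_inl, Sum.elim_inr, Finsupp.sumElim_inl,
            Finsupp.sumElim_inr, id, Finsupp.univ_sum_single]
        simp only [diagSymbol, symbolOp_monomial, outer_monomial, diagOp_monomial, fold,
          MvPolynomial.rename_monomial, he, Finsupp.mapDomain_id]
        congr 1
        simp only [diagWeight, diagWeight₂, Finsupp.sumElim_inl, Finsupp.sumElim_inr,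
          Finsupp.add_apply, Nat.cast_add]
        simp only [add_comm (b _ : K)]
        ring

/-- The product of all variables. -/
noncomputable def varProd (K : Type*) [Field K] (r : ℕ) : MvPolynomial (Fin r) K :=
  ∏ i, MvPolynomial.X i

theorem varProd_isSymmetric : (varProd K r).IsSymmetric := by
  intro e
  simp only [varProd, map_prod, MvPolynomial.rename_X]
  exact Equiv.prod_comp e fun i => (MvPolynomial.X i : MvPolynomial (Fin r) K)

theorem varProd_mem : varProd K r ∈ Submonoid.closure (linearFactors K r) :=
  prod_mem fun i _ => Submonoid.subset_closure (.inl ⟨i, rfl⟩)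

theorem eulerDer_rename_varProd {σ : Type*} [Fintype σ] (w : σ → K) (f : Fin r → σ) :
    eulerDer w (MvPolynomial.rename f (varProd K r)) =
      (∑ i, w (f i)) • MvPolynomial.rename f (varProd K r) := by
  simp only [varProd, map_prod, MvPolynomial.rename_X]
  induction (Finset.univ : Finset (Fin r)) using Finset.induction_on with
  | empty => simp
  | insert i s hi ih =>
    rw [Finset.prod_insert hi, Finset.sum_insert hi, Derivation.leibniz, ih, eulerDer_X, add_smul,
      smul_eq_mul, smul_eq_mul, mul_smul_comm, mul_smul_comm, add_comm,
      mul_comm (∏ i ∈ s, _)]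

open scoped Classical in
/-- The order of the composition of two operations `diagSymbol`. -/
noncomputable def symbolOrder (lam : Fin r → K) : ℕ := r + (Finset.univ.filter fun i => lam i ≠ 0).card

/-- With `x`, `y` the two sets of coefficient variables, the inserted power of `u = ∏ x_i - ∏ y_i`
has exponent equal to the number of affine factors in `s`. Thus each of these must differentiate
`u`, and only the factors with `λ_i = 0` of the inner operation still act on `g`. -/
theorem fold_diagWeight₂ [CharZero K] {lam : Fin r → K} (mu : Fin r → K) (hlam : ∀ i, lam i ≠ 1) :
    ∃ κ : K, κ ≠ 0 ∧ ∀ c c' g : MvPolynomial (Fin r) K,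
      fold K r (diagOp (diagWeight₂ lam mu)
        ((MvPolynomial.rename .inl (varProd K r) -
          MvPolynomial.rename (fun i => .inr (.inl i)) (varProd K r)) ^ symbolOrder lam *
            outer c (outer c' g))) =
        κ • (varProd K r ^ symbolOrder lam * (c * (c' * zeroOp lam mu g))) := by
  classical
  set A := Finset.univ.filter fun i => lam i ≠ 0 with hA
  set s : Finset (Fin r ⊕ Fin r) := Finset.univ.disjSum A with hs
  have hcard : symbolOrder lam = s.card := by
    rw [hs, Finset.card_disjSum, Finset.card_univ, Fintype.card_fin, symbolOrder]
  set w : Fin r ⊕ Fin r → Fin r ⊕ (Fin r ⊕ Fin r) → K := Sum.elim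
    (fun i => Sum.elim (fun l => if l = i then lam i else 0)
      (Sum.elim (fun l => if l = i then 1 else 0) fun l => if l = i then 1 else 0))
    (fun i => Sum.elim (fun _ => 0)
      (Sum.elim (fun l => if l = i then lam i else 0) fun l => if l = i then 1 else 0)) with hw
  set κ : Fin r ⊕ Fin r → K := Sum.elim (fun i => mu i + lam i) fun i => mu i + lam i
  have hF : diagWeight₂ lam mu = fun e => (∏ k ∈ s, affineWeight (w k) (κ k) e) *
      ∏ i with lam i = 0, ((e (.inr (.inr i)) : K) + mu i) := by
    funext e
    rw [diagWeight₂, hs, Finset.prod_disjSum, mul_assoc]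
    congr 1
    · refine Finset.prod_congr rfl fun i _ => ?_
      simp [affineWeight, hw, κ]
      ring
    · rw [← Finset.prod_filter_mul_prod_filter_not Finset.univ fun i => lam i ≠ 0]
      congr 1
      · refine Finset.prod_congr rfl fun i _ => ?_
        simp [affineWeight, hw, κ]
        ring
      · refine Finset.prod_congr (by simp) fun i hi => ?_
        simp [(by simpa using hi : lam i = 0)]
  -- An outer factor multiplies `∏ x` by `λ_i` and `∏ y` by `1`, giving `λ_i - 1` after the
  -- variables are identified; an inner factor multiplies them by `0` and `λ_i`, giving `-λ_i`.
  refine ⟨s.card.factorial * ((∏ i, (lam i - 1)) * ∏ i ∈ A, (-lam i)), ?_, fun c c' g => ?_⟩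
  · refine mul_ne_zero (Nat.cast_ne_zero.2 (Nat.factorial_ne_zero _)) (mul_ne_zero
      (Finset.prod_ne_zero_iff.2 fun i _ => sub_ne_zero.2 (hlam i))
      (Finset.prod_ne_zero_iff.2 fun i hi => neg_ne_zero.2 ?_))
    simpa [hA] using hi
  set u : MvPolynomial (Fin r ⊕ (Fin r ⊕ Fin r)) K := MvPolynomial.rename .inl (varProd K r) -
    MvPolynomial.rename (fun i => .inr (.inl i)) (varProd K r) with hu
  have hfold : ∀ f : Fin r → Fin r ⊕ (Fin r ⊕ Fin r),
      Sum.elim id (Sum.elim id id) ∘ f = id → ∀ p : MvPolynomial (Fin r) K,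
      fold K r (MvPolynomial.rename f p) = p := fun f hf p => by
    rw [fold, MvPolynomial.rename_rename, hf, MvPolynomial.rename_id_apply]
  have hu0 : fold K r u = 0 := by
    rw [hu, map_sub, hfold _ rfl, hfold _ rfl, sub_self]
  have houter : ∀ h : MvPolynomial (Fin r) K, u ^ s.card * outer c (outer c' h) =
      MvPolynomial.rename (Sum.elim .inl fun i => .inr (.inl i))
        ((MvPolynomial.rename .inl (varProd K r) - MvPolynomial.rename .inr (varProd K r)) ^ s.card *
          outer c c') * MvPolynomial.rename (fun i => .inr (.inr i)) h := fun h => by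
    simp only [outer, map_mul, map_pow, map_sub, MvPolynomial.rename_rename, Function.comp_def,
      Sum.elim_inl, Sum.elim_inr, hu]
    ring
  -- The inner factors with `λ_i = 0` involve only the exponents of `g`, so they pass through `u`,
  -- `c` and `c'`.
  have hz : diagOp (fun e : Fin r ⊕ (Fin r ⊕ Fin r) →₀ ℕ =>
      ∏ i with lam i = 0, ((e (.inr (.inr i)) : K) + mu i)) (u ^ s.card * outer c (outer c' g)) =
      u ^ s.card * outer c (outer c' (zeroOp lam mu g)) := by
    rw [houter, houter, zeroOp]
    refine diagOp_rename_mul_rename _ _ _ _ (fun a m => Finset.prod_congr (by congr!) fun i _ => ?_) _ _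
    have hm : m.mapDomain (fun i => (.inr (.inr i) : Fin r ⊕ (Fin r ⊕ Fin r))) (.inr (.inr i)) =
        m i := Finsupp.mapDomain_apply (Sum.inr_injective.comp Sum.inr_injective) m i
    rw [Finsupp.add_apply, Finsupp.mapDomain_of_notMem_range, zero_add, hm]
    rintro ⟨v | v, hv⟩ <;> simp at hv
  rw [hF, diagOp_mul, hcard, hz, map_diagOp_prod_pow_mul hu0, fold_outer]
  have hd1 : ∀ i, fold K r (eulerDer (w (.inl i)) u) = (lam i - 1) • varProd K r := fun i => by
    rw [hu, map_sub, eulerDer_rename_varProd, eulerDer_rename_varProd, map_sub, map_smul, map_smul,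
      hfold _ rfl, hfold _ rfl, ← sub_smul]
    simp [hw]
  have hd2 : ∀ i, fold K r (eulerDer (w (.inr i)) u) = (-lam i) • varProd K r := fun i => by
    rw [hu, map_sub, eulerDer_rename_varProd, eulerDer_rename_varProd, map_sub, map_smul, map_smul,
      hfold _ rfl, hfold _ rfl, ← sub_smul]
    simp [hw]
  simp only [hs, Finset.prod_disjSum, hd1, hd2, Finset.prod_smul, Finset.prod_const,
    Finset.card_disjSum, smul_mul_smul_comm, ← pow_add]
  rw [mul_smul_comm, smul_mul_assoc, mul_assoc, ← nsmul_eq_mul, ← Nat.cast_smul_eq_nsmul K,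
    smul_smul, mul_comm]

/-- The multiplier of `zeroOp_mem`. -/
noncomputable def multiplier (lam : Fin r → K) : MvPolynomial (Fin r) K :=
  varProd K r ^ symbolOrder lam * (discFactor K r * discFactor K r)

theorem multiplier_mem (lam : Fin r → K) :
    multiplier lam ∈ Submonoid.closure (linearFactors K r) :=
  mul_mem (pow_mem varProd_mem _) (mul_mem discFactor_mem discFactor_mem)

theorem isSymmetric_pow {p : MvPolynomial (Fin r) K} (hp : p.IsSymmetric) (n : ℕ) :
    (p ^ n).IsSymmetric := fun e => by rw [map_pow, hp e]

theorem multiplier_isSymmetric (lam : Fin r → K) : (multiplier lam).IsSymmetric :=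
  (isSymmetric_pow varProd_isSymmetric _).mul (discFactor_isSymmetric.mul discFactor_isSymmetric)

/-- The binomial expansion of `(∏ x - ∏ y) ^ d` separates the two sets of variables. Each term is a
composition of two operations with symmetric coefficients, hence preserves `N`. -/
theorem zeroOp_mem [CharZero K] {lam mu : Fin r → K} (hlam : ∀ i, lam i ≠ 1)
    {N : Submodule K (MvPolynomial (Fin r) K)}
    (hN : IsStable (twistedField (stdTwist lam mu)) N) {g : MvPolynomial (Fin r) K} (hg : g ∈ N)
    {t : MvPolynomial (Fin r) K} (ht : t.IsSymmetric) :
    multiplier lam * (t * zeroOp lam mu g) ∈ N := by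
  obtain ⟨κ, hκ, h⟩ := fold_diagWeight₂ mu hlam
  have key := h (discFactor K r * t) (discFactor K r) g
  set d := symbolOrder lam
  have hexp : (MvPolynomial.rename .inl (varProd K r) -
      MvPolynomial.rename (fun i => .inr (.inl i)) (varProd K r)) ^ d *
        outer (discFactor K r * t) (outer (discFactor K r) g) =
      ∑ m ∈ Finset.range (d + 1), ((-1) ^ (d - m) * (d.choose m : K)) •
        outer (discFactor K r * (varProd K r ^ m * t))
          (outer (discFactor K r * varProd K r ^ (d - m)) g) := by
    rw [sub_eq_add_neg, add_pow, Finset.sum_mul]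
    refine Finset.sum_congr rfl fun m _ => ?_
    simp only [outer, map_mul, map_pow, MvPolynomial.rename_rename, Function.comp_def,
      MvPolynomial.smul_eq_C_mul, map_neg, map_one, map_natCast]
    rw [neg_pow (MvPolynomial.rename _ (varProd K r))]
    ring
  rw [hexp, map_sum, map_sum] at key
  simp only [map_smul, ← diagSymbol_diagSymbol] at key
  rw [multiplier, ← N.smul_mem_iff hκ]
  have : varProd K r ^ d * (discFactor K r * t * (discFactor K r * zeroOp lam mu g)) =
      varProd K r ^ d * (discFactor K r * discFactor K r) * (t * zeroOp lam mu g) := by ring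
  rw [← this, ← key]
  refine sum_mem fun m _ => N.smul_mem _ (diagSymbol_mem hN (diagSymbol_mem hN hg ?_) ?_)
  · exact isSymmetric_pow varProd_isSymmetric _
  · exact (isSymmetric_pow varProd_isSymmetric _).mul ht

/-- A differential operator of order at most `d` is killed by `d + 1` commutators with
multiplication by `f`; here `d` is the number of indices with `λ_i = 0`. -/
theorem exists_sum_pow_mul_zeroOp (lam mu : Fin r → K) :
    ∃ n, ∀ f q : MvPolynomial (Fin r) K, ∑ m ∈ Finset.range (n + 1),
      ((-1) ^ m * (n.choose m : K)) • (f ^ (n - m) * zeroOp lam mu (f ^ m * q)) = 0 := by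
  classical
  set s := Finset.univ.filter fun i => lam i = 0
  refine ⟨s.card + 1, fun f q => ?_⟩
  set u : MvPolynomial (Fin r ⊕ Fin r) K :=
    MvPolynomial.rename .inl f - MvPolynomial.rename .inr f with hu
  set w : Fin r → Fin r ⊕ Fin r → K :=
    fun i => Sum.elim (fun _ => 0) fun l => if l = i then 1 else 0 with hw
  have hu0 : MvPolynomial.rename (Sum.elim id id) u = 0 := by
    rw [hu, map_sub, MvPolynomial.rename_rename, MvPolynomial.rename_rename]
    exact sub_self _
  have key := map_diagOp_prod_pow_mul_eq_zero (s := s) (w := w) (κ := mu) hu0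
    (v := MvPolynomial.rename .inr q) (Nat.lt_succ_self _)
  have hexp : u ^ (s.card + 1) * MvPolynomial.rename .inr q =
      ∑ m ∈ Finset.range (s.card + 1 + 1), ((-1) ^ m * ((s.card + 1).choose m : K)) •
        (MvPolynomial.rename .inl (f ^ (s.card + 1 - m)) *
          MvPolynomial.rename .inr (f ^ m * q)) := by
    rw [hu, sub_eq_neg_add, add_pow, Finset.sum_mul]
    refine Finset.sum_congr rfl fun m _ => ?_
    simp only [map_mul, map_pow, MvPolynomial.smul_eq_C_mul, map_neg, map_one, map_natCast]
    rw [neg_pow]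
    ring
  rw [Nat.succ_eq_add_one, hexp, map_sum, map_sum] at key
  rw [← key]
  refine Finset.sum_congr rfl fun m _ => ?_
  rw [map_smul, map_smul, diagOp_rename_mul_rename Sum.inl Sum.inr
    (fun m => ∏ i ∈ s, ((m i : K) + mu i)),
    map_mul (MvPolynomial.rename _), MvPolynomial.rename_rename,
    MvPolynomial.rename_rename]
  · congr 1
    refine congr_arg₂ _ (MvPolynomial.rename_id_apply _).symm ?_
    refine Eq.trans ?_ (MvPolynomial.rename_id_apply _).symm
    rw [zeroOp]
  · intro a m
    refine Finset.prod_congr rfl fun i _ => ?_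
    simp [affineWeight, hw, Finsupp.mapDomain_apply Sum.inr_injective,
      Finsupp.mapDomain_of_notMem_range]

end Quadratic

/-! ### Noetherianity over symmetric polynomials and the generic case -/

section Noetherian

variable {K : Type*} [Field K] {r : ℕ}

theorem isIntegral_symmetricSubalgebra (p : MvPolynomial (Fin r) K) :
    IsIntegral (MvPolynomial.symmetricSubalgebra (Fin r) K) p := by
  set S := MvPolynomial.symmetricSubalgebra (Fin r) K
  have hX : ∀ i, IsIntegral S (MvPolynomial.X i : MvPolynomial (Fin r) K) := by
    intro i
    -- Each variable is a root of this monic polynomial, whose coefficients are symmetric.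
    set P : Polynomial (MvPolynomial (Fin r) K) :=
      ∏ j, (Polynomial.X - Polynomial.C (MvPolynomial.X j)) with hP
    have hmonic : P.Monic := Polynomial.monic_prod_of_monic _ _ fun j _ => Polynomial.monic_X_sub_C _
    have hsymm : ∀ n, (P.coeff n).IsSymmetric := by
      intro n e
      have h : P.map (MvPolynomial.rename e).toRingHom = P := by
        rw [hP, Polynomial.map_prod]
        refine Eq.trans ?_ (Equiv.prod_comp e _)
        simp
      conv_rhs => rw [← h]
      rw [Polynomial.coeff_map]
      rfl
    obtain ⟨Q, hQ, -, hQm⟩ := Polynomial.lifts_and_natDegree_eq_and_monic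
      (f := algebraMap S (MvPolynomial (Fin r) K)) (p := P)
      ((Polynomial.lifts_iff_coeff_lifts _).2 fun n => ⟨⟨P.coeff n, hsymm n⟩, rfl⟩) hmonic
    refine ⟨Q, hQm, ?_⟩
    rw [← Polynomial.eval_map, hQ, hP, Polynomial.eval_prod]
    exact Finset.prod_eq_zero (Finset.mem_univ i) (by simp)
  induction p using MvPolynomial.induction_on with
  | C c => exact isIntegral_algebraMap (x := algebraMap K S c)
  | add p q hp hq => exact hp.add hq
  | mul_X p i hp => exact hp.mul (hX i)

instance isNoetherian_symmetricSubalgebra :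
    IsNoetherian (MvPolynomial.symmetricSubalgebra (Fin r) K) (MvPolynomial (Fin r) K) := by
  set S := MvPolynomial.symmetricSubalgebra (Fin r) K
  have : IsNoetherianRing S := isNoetherianRing_of_ringEquiv _
    (MvPolynomial.esymmAlgEquiv (Fin r) K (Fintype.card_fin r)).toRingEquiv
  have : Algebra.IsIntegral S (MvPolynomial (Fin r) K) := ⟨isIntegral_symmetricSubalgebra⟩
  have : Algebra.FiniteType S (MvPolynomial (Fin r) K) :=
    Algebra.FiniteType.of_restrictScalars_finiteType K S _
  have : Module.Finite S (MvPolynomial (Fin r) K) := Algebra.IsIntegral.finite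
  infer_instance

/-- A subspace which is stable under an injective diagonal operator contains every polynomial whose
image it contains. -/
theorem mem_of_diagOp_mem {σ : Type*} {F : (σ →₀ ℕ) → K} (hF : ∀ m, F m ≠ 0)
    {P : Submodule K (MvPolynomial σ K)} (hP : ∀ p ∈ P, diagOp F p ∈ P)
    {x : MvPolynomial σ K} (hx : diagOp F x ∈ P) : x ∈ P := by
  have hinj : Function.Injective (diagOp F) := by
    refine (injective_iff_map_eq_zero _).2 fun p hp => MvPolynomial.ext _ _ fun m => ?_
    have := congr_arg (MvPolynomial.coeff m) hp
    rw [coeff_diagOp, MvPolynomial.coeff_zero] at this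
    simpa [hF m] using this
  -- Diagonal operators preserve the finite-dimensional span of the monomials of `x`, so on `P ⊓ V`
  -- injectivity implies surjectivity.
  set V : Submodule K (MvPolynomial σ K) := Submodule.span K
    ((fun m => MvPolynomial.monomial m (1 : K)) '' (x.support : Set (σ →₀ ℕ))) with hV
  have : FiniteDimensional K V :=
    FiniteDimensional.span_of_finite K (x.support.finite_toSet.image _)
  have hxV : x ∈ V := by
    rw [x.as_sum]
    refine sum_mem fun m hm => ?_
    rw [← mul_one (x.coeff m), ← smul_eq_mul, ← MvPolynomial.smul_monomial]
    exact V.smul_mem _ (Submodule.subset_span ⟨m, hm, rfl⟩)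
  have hVF : ∀ p ∈ V, diagOp F p ∈ V := by
    intro p hp
    induction hp using Submodule.span_induction with
    | mem p hp =>
      obtain ⟨m, hm, rfl⟩ := hp
      rw [diagOp_monomial, ← smul_eq_mul, ← MvPolynomial.smul_monomial]
      exact V.smul_mem _ (Submodule.subset_span ⟨m, hm, rfl⟩)
    | zero => simp
    | add p q _ _ hp hq =>
      rw [map_add]
      exact add_mem hp hq
    | smul c p _ hp =>
      rw [map_smul]
      exact V.smul_mem _ hp
  have hW : ∀ p ∈ P ⊓ V, diagOp F p ∈ P ⊓ V := fun p hp => ⟨hP p hp.1, hVF p hp.2⟩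
  have : FiniteDimensional K ↥(P ⊓ V) := Submodule.finiteDimensional_of_le inf_le_right
  have hsurj : Function.Surjective ((diagOp F).restrict hW) :=
    LinearMap.injective_iff_surjective.1 fun p q hpq =>
      Subtype.ext (hinj (congr_arg Subtype.val hpq))
  obtain ⟨y, hy⟩ := hsurj ⟨diagOp F x, hx, hVF x hxV⟩
  rw [← hinj (congr_arg Subtype.val hy)]
  exact y.2.1

theorem noeth_stdTwist_of_generic [CharZero K] (H : NoethModFactors K r) {lam mu : Fin r → K}
    (hlam : ∀ i, lam i ≠ 1) (hmu : ∀ i (m : ℕ), (m : K) + mu i ≠ 0) :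
    Noeth (twistedField (stdTwist lam mu)) := by
  classical
  intro N hN
  set S := MvPolynomial.symmetricSubalgebra (Fin r) K with hS
  set f := multiplier lam with hf
  set D := zeroOp lam mu with hD
  let fS : S := ⟨f, multiplier_isSymmetric lam⟩
  have hfS : ∀ p : MvPolynomial (Fin r) K, ∀ k : ℕ, f ^ k * p = fS ^ k • p := fun p k => rfl
  -- the `S`-modules generated by the images of the subspaces of the chain
  let Q : ℕ →o Submodule S (MvPolynomial (Fin r) K) :=
    ⟨fun n => Submodule.span S (D '' (N n : Set (MvPolynomial (Fin r) K))), fun n m h =>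
      Submodule.span_mono (Set.image_mono (N.monotone h))⟩
  obtain ⟨n₀, hn₀⟩ := monotone_stabilizes_iff_noetherian.2
    (inferInstanceAs (IsNoetherian S (MvPolynomial (Fin r) K))) Q
  have hQN : ∀ n, ∀ p ∈ Q n, ∀ t : S, f * (t • p) ∈ N n := by
    intro n p hp
    induction hp using Submodule.span_induction with
    | mem p hp =>
      obtain ⟨g, hg, rfl⟩ := hp
      exact fun t => zeroOp_mem hlam (hN n) hg t.2
    | zero => simp
    | add p q _ _ hp hq =>
      intro t
      rw [smul_add, mul_add]
      exact add_mem (hp t) (hq t)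
    | smul s p _ hp =>
      intro t
      rw [smul_smul]
      exact hp _
  have hQN' : ∀ p ∈ Q n₀, ∀ n, n₀ ≤ n → f * p ∈ N n := fun p hp n hn => by
    simpa using hQN n p (hn₀ n hn ▸ hp) 1
  have hDN : ∀ n, n₀ ≤ n → ∀ p ∈ N n, D p ∈ Q n₀ := fun n hn p hp => by
    rw [hn₀ n hn]
    exact Submodule.subset_span ⟨p, hp, rfl⟩
  -- the saturation with respect to `f`
  let A : ℕ →o Submodule S (MvPolynomial (Fin r) K) :=
    ⟨fun k => (Q n₀).comap (LinearMap.lsmul S (MvPolynomial (Fin r) K) (fS ^ k)),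
      monotone_nat_of_le_succ fun k p hp => by
        change fS ^ (k + 1) • p ∈ Q n₀
        rw [pow_succ', mul_smul]
        exact Submodule.smul_mem _ _ hp⟩
  obtain ⟨k₀, hk₀⟩ := monotone_stabilizes_iff_noetherian.2
    (inferInstanceAs (IsNoetherian S (MvPolynomial (Fin r) K))) A
  have hA : ∀ k p, p ∈ A k ↔ f ^ k * p ∈ Q n₀ := fun k p => Iff.rfl
  have hsat : ∀ k p, f ^ k * p ∈ A k₀ → p ∈ A k₀ := fun k p hp => by
    rw [hk₀ (k₀ + k) (by omega), hA, pow_add, mul_assoc]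
    exact hp
  have hQA : ∀ p ∈ Q n₀, p ∈ A k₀ := fun p hp => A.monotone (Nat.zero_le k₀) (by
    rw [hA, pow_zero, one_mul]
    exact hp)
  obtain ⟨b, hb⟩ := exists_sum_pow_mul_zeroOp lam mu
  -- The vanishing iterated commutator expresses `f ^ b * D q` through the `D (f ^ (j + 1) * q)`;
  -- saturation then cancels `f ^ b`.
  have hstep : ∀ q, (∀ j, D (f ^ (j + 1) * q) ∈ A k₀) → D q ∈ A k₀ := by
    intro q hq
    have h := hb f q
    rw [Finset.sum_range_succ'] at h
    refine hsat b _ ?_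
    simp only [pow_zero, Nat.choose_zero_right, Nat.cast_one, one_mul, one_smul, Nat.sub_zero,
      add_comm _ (f ^ b * _)] at h
    rw [eq_neg_of_add_eq_zero_left h]
    refine neg_mem (sum_mem fun m _ => ?_)
    rw [hfS]
    exact ((A k₀).restrictScalars K).smul_mem _ ((A k₀).smul_mem _ (hq m))
  have hDA : ∀ p ∈ A k₀, D p ∈ A k₀ := by
    intro p hp
    have hbig : ∀ j, D (f ^ (k₀ + 1 + j) * p) ∈ A k₀ := by
      intro j
      refine hQA _ (hDN n₀ le_rfl _ ?_)
      have h : f ^ (k₀ + 1 + j) * p = f * (f ^ j * (f ^ k₀ * p)) := by ring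
      rw [h, hfS _ j]
      exact hQN' _ ((Q n₀).smul_mem _ hp) n₀ le_rfl
    -- Descent on the power of `f`: `hbig` covers all exponents from `k₀ + 1` on, and each use of
    -- `hstep` lowers the bound by one until it is `0`.
    have hall : ∀ i, i ≤ k₀ + 1 → ∀ j, D (f ^ (k₀ + 1 - i + j) * p) ∈ A k₀ := by
      intro i
      induction i with
      | zero => exact fun _ => hbig
      | succ i ih =>
        intro hi j
        cases j with
        | zero =>
          refine hstep _ fun j => ?_
          rw [← mul_assoc, ← pow_add]
          have := ih (by omega) j
          rwa [show k₀ + 1 - i + j = j + 1 + (k₀ + 1 - (i + 1) + 0) by omega] at this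
        | succ j =>
          have := ih (by omega) j
          rwa [show k₀ + 1 - i + j = k₀ + 1 - (i + 1) + (j + 1) by omega] at this
    simpa using hall (k₀ + 1) le_rfl 0
  have hinv : ∀ x, D x ∈ A k₀ → x ∈ A k₀ := fun x hx =>
    mem_of_diagOp_mem (P := (A k₀).restrictScalars K)
      (fun m => Finset.prod_ne_zero_iff.2 fun i _ => hmu i (m i)) hDA hx
  -- Of the `k₀ + 1` factors `f`, `k₀` bring an element of `A k₀` into `Q n₀`, and the last brings
  -- it into the chain.
  obtain ⟨n₁, hn₁⟩ := H.mul (pow_mem (multiplier_mem lam) (k₀ + 1)) _ (stdTwist_mem lam mu) N hN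
  refine ⟨max n₀ n₁, fun m hm x hx => ?_⟩
  rw [sup_bot_eq]
  have hn₁' : N n₁ ≤ N (max n₀ n₁) := N.monotone (le_max_right _ _)
  obtain ⟨y, hy, _, ⟨q, rfl⟩, rfl⟩ := Submodule.mem_sup.1 (hn₁ m (le_of_max_le_right hm) hx)
  rw [LinearMap.mulLeft_apply] at hx ⊢
  refine add_mem (hn₁' hy) ?_
  have hq : f ^ (k₀ + 1) * q ∈ N m := by
    simpa using (N m).sub_mem hx (N.monotone (le_of_max_le_right hm) hy)
  have hqA : q ∈ A k₀ := hsat (k₀ + 1) q (hinv _ (hQA _ (hDN m (le_of_max_le_left hm) _ hq)))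
  have := hQN' _ ((hA k₀ q).1 hqA) (max n₀ n₁) (le_max_left _ _)
  rwa [← mul_assoc, ← pow_succ'] at this

end Noetherian

/-! ### Removal of the genericity assumptions -/

section Reduction

variable {K : Type*} [Field K] {r : ℕ}

-- This is the de Rham differential from functions to one-forms in each variable with `λ_i = 1`:
-- `d(z^{m+μ+1}) = (m+μ+1) z^{m+μ} dz`. It intertwines the parameters `(0, μ_i + 1)` with `(1,
-- μ_i)`.
open scoped Classical in
theorem diagOp_fieldOp (lam mu : Fin r → K) (k : ℕ) (p : MvPolynomial (Fin r) K) :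
    diagOp (fun m => ∏ i with lam i = 1, ((m i : K) + (mu i + 1)))
        (fieldOp (fun i => if lam i = 1 then 0 else lam i)
          (fun i => if lam i = 1 then mu i + 1 else mu i) k p) =
      fieldOp lam mu k
        (diagOp (fun m => ∏ i with lam i = 1, ((m i : K) + (mu i + 1))) p) := by
  induction p using MvPolynomial.induction_on' with
  | add p q hp hq => simp only [map_add, hp, hq]
  | monomial m c =>
    rw [fieldOp_monomial, diagOp_monomial, fieldOp_monomial, map_sum]
    refine Finset.sum_congr rfl fun i _ => ?_
    rw [diagOp_monomial]
    congr 1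
    have herase : ∀ j, j ≠ i → (((m + Finsupp.single i k : Fin r →₀ ℕ) j : ℕ) : K) = m j :=
      fun j hj => by simp [Finsupp.single_eq_of_ne hj]
    by_cases hi : lam i = 1
    · have hmem : i ∈ Finset.univ.filter fun i => lam i = 1 := by simpa using hi
      rw [← Finset.mul_prod_erase _ _ hmem, ← Finset.mul_prod_erase _ _ hmem,
        Finset.prod_congr rfl fun j hj => by rw [herase j (Finset.ne_of_mem_erase hj)]]
      simp only [hi, if_true, Finsupp.add_apply, Finsupp.single_eq_same, Nat.cast_add]
      ring
    · rw [Finset.prod_congr rfl fun j hj => by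
        rw [herase j (by rintro rfl; exact hi (by simpa using hj))]]
      simp only [hi, if_false]
      ring

theorem diagOp_surjective {σ : Type*} {F : (σ →₀ ℕ) → K} (hF : ∀ m, F m ≠ 0) :
    Function.Surjective (diagOp F) := fun p => ⟨diagOp (fun m => (F m)⁻¹) p, by
  rw [← diagOp_mul]
  simp only [mul_inv_cancel₀ (hF _)]
  exact diagOp_one p⟩

/-- For generic `μ` the differential has no zero weights and is therefore surjective, so every `λ_i
= 1` can be traded for `λ_i = 0`. -/
theorem noeth_stdTwist_of_generic_mu [CharZero K] (H : NoethModFactors K r) (lam : Fin r → K)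
    {mu : Fin r → K} (hmu : ∀ i (m : ℕ), (m : K) + mu i ≠ 0) :
    Noeth (twistedField (stdTwist lam mu)) := by
  classical
  have hmu' : ∀ i (m : ℕ), (m : K) + (mu i + 1) ≠ 0 := fun i m => by
    have := hmu i (m + 1)
    push_cast at this
    rwa [add_assoc, add_comm 1] at this
  refine Noeth.of_surjective (e' := twistedField (stdTwist (fun i => if lam i = 1 then 0 else lam i)
    fun i => if lam i = 1 then mu i + 1 else mu i)) (fun k p => ?_)
    (diagOp_surjective (F := fun m => ∏ i with lam i = 1, ((m i : K) + (mu i + 1)))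
      fun m => Finset.prod_ne_zero_iff.2 fun i _ => hmu' i _)
    (noeth_stdTwist_of_generic H (fun i => ?_) fun i m => ?_)
  · rw [← fieldOp_succ, ← fieldOp_succ]
    exact diagOp_fieldOp lam mu (k + 1) p
  · split_ifs with h
    · exact zero_ne_one
    · exact h
  · split_ifs
    · exact hmu' i m
    · exact hmu i m

theorem vectorField_prod_X_pow (n : Fin r → ℕ) (k : ℕ) :
    vectorField K r (k + 1) (∏ i, MvPolynomial.X i ^ n i) =
      stdTwist 0 (fun i => (n i : K)) k * ∏ i, MvPolynomial.X i ^ n i := by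
  simp only [stdTwist, Pi.zero_apply, mul_zero, add_zero]
  induction (Finset.univ : Finset (Fin r)) using Finset.induction_on with
  | empty => simp
  | insert i s hi ih =>
    rw [Finset.prod_insert hi, Finset.sum_insert hi, Derivation.leibniz, ih,
      Derivation.leibniz_pow, vectorField_X]
    simp only [smul_eq_mul, nsmul_eq_mul, map_natCast]
    cases n i with
    | zero => simp
    | succ j =>
      simp only [Nat.add_sub_cancel]
      ring

/-- Multiplication by `∏ z_i ^ n_i` embeds the module with parameters `μ + n`; chains in the
quotient are controlled by `H`, and `n` is chosen to make `μ + n` generic. -/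
theorem noeth_stdTwist_of_noethModFactors [CharZero K] (H : NoethModFactors K r)
    (lam mu : Fin r → K) : Noeth (twistedField (stdTwist lam mu)) := by
  have hn : ∀ i, ∃ n : ℕ, ∀ m : ℕ, (m : K) + (mu i + n) ≠ 0 := by
    intro i
    by_cases h : ∃ n : ℕ, mu i = -n
    · obtain ⟨n, hn⟩ := h
      -- The shift by `n + 1` moves `μ_i = -n` to `1`.
      refine ⟨n + 1, fun m => ?_⟩
      rw [hn]
      push_cast
      rw [neg_add_cancel_left]
      exact Nat.cast_add_one_ne_zero m
    · refine ⟨0, fun m hm => h ⟨m, ?_⟩⟩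
      rw [Nat.cast_zero, add_zero] at hm
      exact eq_neg_of_add_eq_zero_right hm
  choose n hn using hn
  have hstd : stdTwist lam (mu + fun i => (n i : K)) =
      stdTwist lam mu + stdTwist 0 fun i => (n i : K) := by
    funext k
    rw [Pi.add_apply, ← stdTwist_add, add_zero]
  have hmem : ∏ i, MvPolynomial.X i ^ n i ∈ Submonoid.closure (linearFactors K r) :=
    prod_mem fun i _ => pow_mem (Submonoid.subset_closure (.inl ⟨i, rfl⟩)) _
  refine Noeth.extend (twistedField_mul (vectorField_prod_X_pow n))
    (H.mul hmem _ (stdTwist_mem lam mu)) ?_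
  rw [← hstd]
  exact noeth_stdTwist_of_generic_mu H lam hn

theorem noeth_stdTwist [CharZero K] (lam mu : Fin r → K) :
    Noeth (twistedField (stdTwist lam mu)) := by
  induction r with
  | zero =>
    refine noeth_stdTwist_of_noethModFactors (fun a _ g hg => ?_) lam mu
    rcases hg with ⟨i, -⟩ | ⟨i, -⟩ <;> exact i.elim0
  | succ r ih =>
    exact noeth_stdTwist_of_noethModFactors
      (fun a ha g hg => noethMod_linearFactor ih ha hg) lam mu

end Reduction

/-! ### From polynomials to the tensor product -/

section Transfer

variable {K : Type*} [Field K] {r : ℕ}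

/-- The element `z ^ m (z ^ μ ∂ ^ (-λ))`. -/
noncomputable def tensorMonomial (lam mu : K) (m : ℕ) : TensorField K lam mu := (X ^ m : K[X])

/-- The element `e_{k+1}` of `L₁`. -/
noncomputable def basisField (K : Type*) [Field K] (k : ℕ) : L1 K :=
  ⟨mkDerivation K (X ^ (k + 2)), by
    change (X : K[X]) ^ 2 ∣ mkDerivation K (X ^ (k + 2) : K[X]) X
    rw [mkDerivation_X]
    exact pow_dvd_pow _ (by omega)⟩

theorem basisField_tensorMonomial (lam mu : K) (k m : ℕ) :
    ⁅basisField K k, tensorMonomial lam mu m⁆ =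
      (m + mu + (k + 2) * lam) • tensorMonomial lam mu (m + (k + 1)) := by
  change TensorField.action lam mu (mkDerivation K (X ^ (k + 2) : K[X])) (X ^ m : K[X]) =
    (m + mu + (k + 2) * lam) • (X ^ (m + (k + 1)) : K[X])
  have hdiv : (X ^ (k + 2) : K[X]).divX = X ^ (k + 1) := by
    rw [show k + 2 = (k + 1) + 1 from rfl, divX_X_pow]
    simp
  simp only [TensorField.action, mkDerivation_X, hdiv, derivative_X_pow, smul_eq_C_mul, C_add,
    C_mul, map_natCast, Nat.cast_add, Nat.cast_ofNat, show C (2 : K) = (2 : K[X]) from rfl]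
  cases m with
  | zero =>
    simp only [Nat.cast_zero, zero_mul, mul_zero, zero_add, pow_zero, mul_one,
      show k + 2 - 1 = k + 1 from rfl]
    ring
  | succ m =>
    simp only [Nat.add_sub_cancel, show k + 2 - 1 = k + 1 from rfl]
    ring

theorem lie_tprod (lam mu : Fin r → K) (x : L1 K) (g : ∀ i, TensorField K (lam i) (mu i)) :
    ⁅x, PiTensorProduct.tprod K g⁆ =
      ∑ i, PiTensorProduct.tprod K (Function.update g i ⁅x, g i⁆) := by
  change diagAction (K := K) x (PiTensorProduct.tprod K g) = _
  rw [diagAction, LinearMap.sum_apply, LinearMap.sum_apply]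
  refine Finset.sum_congr rfl fun i _ => ?_
  change PiTensorProduct.map _ _ = _
  rw [PiTensorProduct.map_tprod]
  congr 1
  funext j
  rcases eq_or_ne j i with rfl | h
  · simp
  · simp [Function.update_of_ne h]

/-- The linear map which sends the monomial with exponent `m` to the tensor product of the elements
`z ^ m_i (z ^ μ_i ∂ ^ (-λ_i))`. -/
noncomputable def ofPolynomial (lam mu : Fin r → K) : MvPolynomial (Fin r) K →ₗ[K] TensorFields K lam mu :=
  (MvPolynomial.basisMonomials (Fin r) K).constr K fun m =>
    PiTensorProduct.tprod K fun i => tensorMonomial (lam i) (mu i) (m i)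

theorem ofPolynomial_monomial (lam mu : Fin r → K) (m : Fin r →₀ ℕ) (c : K) :
    ofPolynomial lam mu (MvPolynomial.monomial m c) =
      c • PiTensorProduct.tprod K fun i => tensorMonomial (lam i) (mu i) (m i) := by
  have h : (MvPolynomial.monomial m c : MvPolynomial (Fin r) K) =
      c • MvPolynomial.basisMonomials (Fin r) K m := by
    simp [MvPolynomial.smul_monomial]
  rw [h, map_smul, ofPolynomial, Module.Basis.constr_basis]

theorem ofPolynomial_twistedField (lam mu : Fin r → K) (k : ℕ) (p : MvPolynomial (Fin r) K) :
    ofPolynomial lam mu (twistedField (stdTwist lam mu) k p) =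
      ⁅basisField K k, ofPolynomial lam mu p⁆ := by
  induction p using MvPolynomial.induction_on' with
  | add p q hp hq => simp only [map_add, lie_add, hp, hq]
  | monomial m c =>
    rw [← fieldOp_succ, fieldOp_monomial, map_sum, ofPolynomial_monomial, lie_smul, lie_tprod,
      Finset.smul_sum]
    refine Finset.sum_congr rfl fun i _ => ?_
    rw [ofPolynomial_monomial, basisField_tensorMonomial, MultilinearMap.map_update_smul, smul_smul,
      mul_comm c]
    congr 2
    · push_cast
      ring
    · funext j
      rcases eq_or_ne j i with rfl | h
      · simp
      · simp [Function.update_of_ne h, Finsupp.single_eq_of_ne h]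

/-- The basis of a module of tensor fields. -/
noncomputable def tensorBasis (lam mu : K) : Module.Basis ℕ K (TensorField K lam mu) :=
  Polynomial.basisMonomials K

theorem tensorBasis_apply (lam mu : K) (m : ℕ) :
    tensorBasis lam mu m = tensorMonomial lam mu m := by
  change Polynomial.basisMonomials K m = X ^ m
  rw [Polynomial.coe_basisMonomials, X_pow_eq_monomial]

/-- The map `g_1 ⊗ ⋯ ⊗ g_r ↦ ∏ g_i(z_i)` is a right inverse. Surjectivity is enough, since a chain
can be compared through its preimages. -/
theorem ofPolynomial_surjective (lam mu : Fin r → K) :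
    Function.Surjective (ofPolynomial lam mu) := by
  let Φ : MultilinearMap K (fun i => TensorField K (lam i) (mu i)) (MvPolynomial (Fin r) K) :=
    (MultilinearMap.mkPiAlgebra K (Fin r) (MvPolynomial (Fin r) K)).compLinearMap
      (fun i => ((Polynomial.aeval (MvPolynomial.X i)).toLinearMap :
        K[X] →ₗ[K] MvPolynomial (Fin r) K))
  have key : (ofPolynomial lam mu).compMultilinearMap Φ = PiTensorProduct.tprod K := by
    refine Module.Basis.ext_multilinear
      (fun i => tensorBasis (lam i) (mu i))
      fun v => ?_
    have hv : Φ (fun i => (X ^ v i : K[X])) =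
        MvPolynomial.monomial (Finsupp.equivFunOnFinite.symm v) 1 := by
      rw [MvPolynomial.monomial_eq, Finsupp.prod_fintype _ _ (by simp)]
      change ∏ i, Polynomial.aeval (MvPolynomial.X i) (X ^ v i : K[X]) = _
      simp
    simp only [tensorBasis_apply]
    change ofPolynomial lam mu (Φ fun i => (X ^ v i : K[X])) = _
    rw [hv, ofPolynomial_monomial, one_smul]
    rfl
  intro x
  refine ⟨PiTensorProduct.lift Φ x, ?_⟩
  have : (ofPolynomial lam mu).comp (PiTensorProduct.lift Φ) = LinearMap.id := by
    refine PiTensorProduct.ext (MultilinearMap.ext fun g => ?_)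
    simpa using DFunLike.congr_fun key g
  exact DFunLike.congr_fun this x

end Transfer

end VectorFields

theorem mainTheorem5 {K : Type*} [Field K] [CharZero K] {r : ℕ} (lam mu : Fin r → K) :
    VectorFields.IsNoetherianLieModule K (VectorFields.L1 K)
      (VectorFields.TensorFields K lam mu) := by
  intro N
  let N' : ℕ →o Submodule K (MvPolynomial (Fin r) K) :=
    VectorFields.comapChain (VectorFields.ofPolynomial lam mu)
      ⟨fun n => (N n).toSubmodule, fun _ _ h => N.monotone h⟩
  obtain ⟨n, hn⟩ := VectorFields.noeth_stdTwist lam mu N' fun n k p hp => by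
    change VectorFields.ofPolynomial lam mu _ ∈ N n
    rw [VectorFields.ofPolynomial_twistedField]
    exact (N n).lie_mem hp
  refine ⟨n, fun m hm => le_antisymm (N.monotone hm) fun x hx => ?_⟩
  obtain ⟨p, rfl⟩ := VectorFields.ofPolynomial_surjective lam mu x
  have := hn m hm (show p ∈ N' m from hx)
  rw [sup_bot_eq] at this
  exact this
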